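/- Let $T\ge 2$. For $\delta\in(0,1)$ let $\succsim_\delta$ be the relation on $\mathbb{R}^T$ given by $x\succsim_\delta y\iff\sum_{t=1}^T\delta^t x_t\ge\sum_{t=1}^T\delta^t y_t$, regarded as a subset of $\mathbb{R}^T\times\mathbb{R}^T$, and let $\mathcal{P}_{\mathcal{ED}}=\{\succsim_\delta:\delta\in(0,1)\}$. For a probability measure $\mu$ on $\mathbb{R}^T\times\mathbb{R}^T$, a target $\succsim\,\in\mathcal{P}_{\mathcal{ED}}$ and $R>0$ let $B(\succsim,R)=\{\succsim'\,\in\mathcal{P}_{\mathcal{ED}}:\mu(\succsim\triangle\succsim')\le R\}$; for $V\subseteq\mathcal{P}_{\mathcal{ED}}$ let $\mathrm{Dis}(V)=\bigcup_{h,h'\in V}h\triangle h'$. The disagreement coefficient of $\succsim$ with respect to $\mu$ is $\theta=\sup_{R>0}\mu(\mathrm{Dis}(B(\succsim,R)))/R$. The CAL algorithm processes a stream $z_1,z_2,\dots$ drawn i.i.d. from $\mu$: it starts with $V_0=\mathcal{P}_{\mathcal{ED}}$; if $z_m\in\mathrm{Dis}(V_{m-1})$, it requests the label of $z_m$ (whether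 or not $z_m$ belongs to the target) and lets $V_m$ be the set of all $h\in V_{m-1}$ that agree with this label; otherwise $V_m=V_{m-1}$. Its label complexity $\ell_{CAL}(\varepsilon,\delta)$ is the least $n$ for which there is a number $m$ of unlabelled points such that, for every target in $\mathcal{P}_{\mathcal{ED}}$, with probability more than $1-\delta$, at most $n$ labels are requested among the first $m$ points and every $h\in V_m$ satisfies $\mu(h\triangle\succsim)\le\varepsilon$, where $\succsim$ is the target. Theorem. There is a universal constant $C>0$ such that for every $T\ge2$ there is a Borel probability measure $\mu$ on $\mathbb{R}^T\times\mathbb{R}^T$ with the following properties. 1. $\mu$ is induced by Lebesgue measure on root tuples: identify $z\in\mathbb{R}^T$ with the polynomial $\sum_{t=1}^T z_tX^{t-1}$, and let $\mathbb{R}^T/{\sim}$ be the quotient by multiplication by nonzero real constants, with the quotient $\sigma$-algebra. Then the image of $\mu$ under $(x,y)\mapsto[x-y]$ equals the image of Lebesgue measure on $(0,1)^{T-1}$ under $(r_1,\dots,r_{T-1})\mapsto[\prod_{i=1}^{T-1}(X-r_i)]$. 2. Every $\succsim\,\in\mathcal{P}_{\mathcal{ED}}$ has disagreement coefficient exactly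 $2$ with respect to $\mu$. 3. For all $0<\varepsilon\le\frac12$ and $0<\delta<1$, $$\ell_{CAL}(\varepsilon,\delta)\le C\,\log\frac1\varepsilon\left(\log T+\log\frac{\log(1/\varepsilon)}{\delta}\right).$$ In particular, for fixed $\delta$, $\ell_{CAL}(\varepsilon,\delta)=\widetilde O(\log T\log(1/\varepsilon))$, where $\widetilde O$ suppresses factors logarithmic in $\log T$ and in $\log(1/\varepsilon)$. -/

import Mathlib

open MeasureTheory
open scoped ENNReal

/-! A binary relation on `X` is represented by its graph, a set of pairs in `X × X`; a model of
preference relations is a set of such relations.  The notions of disagreement and of the CAL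
algorithm are stated for a class `P` of subsets of an arbitrary measurable space `α`. -/

/-- Plans: vectors of payoffs over `T` time periods. -/
abbrev Plan (T : ℕ) : Type := Fin T → ℝ

/-- The preference relation with exponential discounting `D(t) = δ ^ t`, `t = 1, …, T`
(the period `t` is `i + 1` for `i : Fin T`). -/
def edPref (T : ℕ) (δ : ℝ) : Set (Plan T × Plan T) :=
  {p | ∑ i : Fin T, δ ^ ((i : ℕ) + 1) * p.2 i ≤ ∑ i : Fin T, δ ^ ((i : ℕ) + 1) * p.1 i}

/-- The exponential discounting model: all relations `edPref T δ` with `δ ∈ (0, 1)`. -/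
def edModel (T : ℕ) : Set (Set (Plan T × Plan T)) :=
  {h | ∃ δ : ℝ, 0 < δ ∧ δ < 1 ∧ h = edPref T δ}

section Disagreement

variable {α : Type*}

/-- The disagreement region of `V`: the union of all symmetric differences of members of `V`. -/
def disRegion (V : Set (Set α)) : Set α :=
  {z | ∃ h ∈ V, ∃ h' ∈ V, z ∈ symmDiff h h'}

/-- The closed ball in the model `P` around `h` for the pseudometric `μ (h ∆ h')`. -/
def prefBall [MeasurableSpace α] (μ : Measure α) (P : Set (Set α)) (h : Set α) (R : ℝ) :
    Set (Set α) :=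
  {h' | h' ∈ P ∧ μ (symmDiff h h') ≤ ENNReal.ofReal R}

/-- The disagreement coefficient of the target `h` in the model `P` with respect to `μ`. -/
noncomputable def disagreementCoeff [MeasurableSpace α] (μ : Measure α) (P : Set (Set α))
    (h : Set α) : ℝ≥0∞ :=
  ⨆ (R : ℝ) (_ : 0 < R), μ (disRegion (prefBall μ P h R)) / ENNReal.ofReal R

open Classical in
/-- The version space of the CAL algorithm after the points `z 0, …, z (m - 1)` of the stream.
A label is requested exactly when the new point lies in the disagreement region of the current
version space, and the hypotheses that contradict the received label are then discarded. -/
noncomputable def calVersion (P : Set (Set α)) (target : Set α) (z : ℕ → α) : ℕ → Set (Set α)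
  | 0 => P
  | m + 1 =>
    if z m ∈ disRegion (calVersion P target z m) then
      {h | h ∈ calVersion P target z m ∧ (z m ∈ h ↔ z m ∈ target)}
    else calVersion P target z m

open Classical in
/-- The number of labels that CAL requests among the first `m` points of the stream `z`. -/
noncomputable def calRequests (P : Set (Set α)) (target : Set α) (z : ℕ → α) (m : ℕ) : ℕ :=
  ((Finset.range m).filter (fun i => z i ∈ disRegion (calVersion P target z i))).card

/-- `n` label requests suffice for CAL with error `ε` and confidence `1 - δ`: there is a number `m`
of unlabelled points such that, for every target in the model, with probability more than `1 - δ`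
over an i.i.d. stream from `μ`, CAL requests at most `n` labels on the first `m` points and every
hypothesis remaining in the version space (any of which it may output) has error at most `ε`. -/
def CALSuffices [MeasurableSpace α] (μ : Measure α) [IsProbabilityMeasure μ] (P : Set (Set α))
    (ε δ : ℝ) (n : ℕ) : Prop :=
  ∃ m : ℕ, ∀ target ∈ P,
    Measure.infinitePi (fun _ : ℕ => μ)
      {z | ¬ (calRequests P target z m ≤ n ∧
        calVersion P target z m ⊆ prefBall μ P target ε)} < ENNReal.ofReal δ

/-- The label complexity of CAL: the least sufficient number of label requests (`⊤` if none). -/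
noncomputable def calLabelComplexity [MeasurableSpace α] (μ : Measure α) [IsProbabilityMeasure μ]
    (P : Set (Set α)) (ε δ : ℝ) : ℕ∞ :=
  ⨅ (n : ℕ) (_ : CALSuffices μ P ε δ n), (n : ℕ∞)

end Disagreement

section RootDistribution

/-- Vectors of `ℝ^T` (coefficient vectors of polynomials of degree at most `T - 1`) up to
multiplication by a nonzero real constant; it carries the quotient of the Borel `σ`-algebra. -/
abbrev CoeffClass (T : ℕ) : Type := MulAction.orbitRel.Quotient ℝˣ (Plan T)

/-- The class of the polynomials of degree `T - 1` with the root tuple `r`. -/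
noncomputable def rootClass (T : ℕ) (r : Fin (T - 1) → ℝ) : CoeffClass T :=
  Quotient.mk _ (fun t : Fin T =>
    (∏ i : Fin (T - 1), (Polynomial.X - Polynomial.C (r i))).coeff (t : ℕ))

/-- The class of `x - y`. -/
def diffClass (T : ℕ) (p : Plan T × Plan T) : CoeffClass T :=
  Quotient.mk _ (p.1 - p.2)

/-- Lebesgue measure on the root tuples in `(0, 1)^(T - 1)`, transported to polynomial classes. -/
noncomputable def rootClassLaw (T : ℕ) : Measure (CoeffClass T) :=
  ((volume : Measure (Fin (T - 1) → ℝ)).restrict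
    (Set.univ.pi fun _ => Set.Ioo (0 : ℝ) 1)).map (rootClass T)

end RootDistribution

/-! A relation with discount factor b labels a pair by whether the polynomial p of x - y is
nonnegative at b. Up to ties, a and b therefore disagree exactly when an odd number of roots
separates them. For N = T - 1 independent uniform roots, the sign of p(a)p(b) is a product of
independent signs of mean 1 - 2|a - b|, so the disagreement probability is `splitProb N |a - b|`
(`rootLaw_real_oddSplit`). `planPair` realises the random polynomial by a pair of plans.

Disagreement coefficient. Write R = `splitProb N l` with l ≤ 1/2. Members of the ball of radius R
around a can disagree on p only if p has a root within distance l of a on the circle ℝ/ℤ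
(`rootProd_mul_pos_of_farSet`), which has probability at most 1 - (1 - 2l)^N = 2R. For small l
almost every p with a root that close to a does cause disagreement, so the value 2 is attained.

Label complexity. If some b of error above r is consistent with n + 1 samples, it can be moved
without lowering its error until it meets a sampled root or reaches one of four fixed points. This
leaves (n + 1)N + 4 candidates. A sampled root is independent of the other n samples, and averaging
over its position gains a factor of order 1/n that cancels n + 1. So the failure probability is O(N
exp(-nr/2)), with no factor n in front (`pi_exists_consistent_le`). With checkpoints A·2^j, the
version space lies in the ball of radius 2^(-j) at the j-th one. The next A·2^j points then request
at most about 2A labels in expectation. About log(1/ε) phases, with A of order log T +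
log(log(1/ε)/δ), suffice (`calSuffices_planLaw`). -/

/-- The uniform distribution on `(0, 1)`. -/
noncomputable def unitLaw : Measure ℝ := volume.restrict (Set.Ioo (0 : ℝ) 1)

instance isProbabilityMeasure_unitLaw : IsProbabilityMeasure unitLaw :=
  ⟨by simp [unitLaw]⟩

instance nullSingleton_unitLaw : NullSingletonClass unitLaw := by
  unfold unitLaw; infer_instance

/-- The law of `N` independent roots, each uniform on `(0, 1)`. -/
noncomputable def rootLaw (N : ℕ) : Measure (Fin N → ℝ) := Measure.pi fun _ => unitLaw

instance isProbabilityMeasure_rootLaw (N : ℕ) : IsProbabilityMeasure (rootLaw N) := by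
  unfold rootLaw; infer_instance

theorem rootLaw_eq_restrict (N : ℕ) :
    rootLaw N = (volume : Measure (Fin N → ℝ)).restrict
      (Set.univ.pi fun _ => Set.Ioo (0 : ℝ) 1) := by
  rw [volume_pi, Measure.restrict_pi_pi]
  rfl

/-! ### Sign changes of a polynomial with random roots -/

/-- The value at `x` of the monic polynomial with roots `r`. -/
def rootProd {N : ℕ} (r : Fin N → ℝ) (x : ℝ) : ℝ := ∏ i, (x - r i)

/-- The root tuples whose monic polynomial has opposite signs at `a` and at `b`. -/
def oddSplit (N : ℕ) (a b : ℝ) : Set (Fin N → ℝ) := {r | rootProd r a * rootProd r b < 0}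

/-- The probability that an odd number of `N` independent uniform roots lies in an interval of
length `l`. -/
noncomputable def splitProb (N : ℕ) (l : ℝ) : ℝ := (1 - (1 - 2 * l) ^ N) / 2

theorem continuous_rootProd_left {N : ℕ} (x : ℝ) :
    Continuous fun r : Fin N → ℝ => rootProd r x := by
  unfold rootProd; fun_prop

theorem measurableSet_oddSplit (N : ℕ) (a b : ℝ) : MeasurableSet (oddSplit N a b) :=
  (isOpen_lt ((continuous_rootProd_left a).mul (continuous_rootProd_left b))
    continuous_const).measurableSet

theorem ae_rootProd_ne_zero (N : ℕ) (a : ℝ) : ∀ᵐ r ∂rootLaw N, rootProd r a ≠ 0 := by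
  have h : ∀ i : Fin N, ∀ᵐ r ∂rootLaw N, r i ≠ a := fun i => by
    have : rootLaw N {r : Fin N → ℝ | r i = a} = 0 :=
      Measure.pi_hyperplane (fun _ : Fin N => unitLaw) i a
    simpa [ae_iff] using this
  filter_upwards [ae_all_iff.2 h] with r hr
  exact Finset.prod_ne_zero_iff.2 fun i _ => sub_ne_zero.2 (hr i).symm

theorem ae_injective (N : ℕ) : ∀ᵐ r ∂rootLaw N, Function.Injective r := by
  have h : ∀ i j : Fin N, i ≠ j → ∀ᵐ r ∂rootLaw N, r i ≠ r j := fun i j hij => by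
    rw [rootLaw_eq_restrict]
    refine ae_restrict_of_ae ?_
    let f : (Fin N → ℝ) →ₗ[ℝ] ℝ := (LinearMap.proj i : (Fin N → ℝ) →ₗ[ℝ] ℝ) - LinearMap.proj j
    have hf : LinearMap.ker f ≠ ⊤ := by
      intro htop
      have : (Pi.single i 1 : Fin N → ℝ) ∈ LinearMap.ker f := htop ▸ Submodule.mem_top
      simp [f, hij.symm] at this
    have h0 := Measure.addHaar_submodule (volume : Measure (Fin N → ℝ)) _ hf
    rw [ae_iff]
    convert h0 using 2
    ext r
    simp [f, sub_eq_zero]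
  have h' : ∀ᵐ r ∂rootLaw N, ∀ i j : Fin N, i ≠ j → r i ≠ r j := by
    simpa only [ae_all_iff] using h
  filter_upwards [h'] with r hr i j hij
  by_contra hne
  exact hr i j hne hij

/-- Trades the probability of a negative sign for the mean of the sign, which is multiplicative over
independent factors. -/
theorem integral_sign_eq {Ω : Type*} [MeasurableSpace Ω] (ν : Measure Ω) [IsProbabilityMeasure ν]
    {Y : Ω → ℝ} (hY : Measurable Y) (h0 : ∀ᵐ w ∂ν, Y w ≠ 0) :
    ∫ w, ((SignType.sign (Y w) : SignType) : ℝ) ∂ν = 1 - 2 * ν.real {w | Y w < 0} := by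
  have hm : MeasurableSet {w | Y w < 0} := measurableSet_lt hY measurable_const
  have h1 : (fun w => ((SignType.sign (Y w) : SignType) : ℝ)) =ᵐ[ν]
      fun w => 1 - 2 * ({w | Y w < 0}.indicator (fun _ => (1 : ℝ)) w) := by
    filter_upwards [h0] with w hw
    rcases lt_or_gt_of_ne hw with h | h
    · simp [h]; norm_num
    · simp [h, h.le]
  rw [integral_congr_ae h1, integral_sub (integrable_const _)
    (((integrable_const (1 : ℝ)).indicator hm).const_mul 2), integral_const_mul,
    integral_indicator_const _ hm]
  simp

theorem unitLaw_real_of_subset {a b : ℝ} (ha : 0 ≤ a) (hab : a ≤ b) (hb : b ≤ 1) :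
    unitLaw.real (Set.Ioo a b) = b - a := by
  have : Set.Ioo a b ∩ Set.Ioo 0 1 = Set.Ioo a b :=
    Set.inter_eq_left.2 (Set.Ioo_subset_Ioo ha hb)
  simp [unitLaw, measureReal_def, Measure.restrict_apply, this, sub_nonneg.2 hab]

theorem integral_sign_unitLaw {a b : ℝ} (ha : a ∈ Set.Icc (0 : ℝ) 1) (hb : b ∈ Set.Icc (0 : ℝ) 1) :
    ∫ x, ((SignType.sign ((a - x) * (b - x)) : SignType) : ℝ) ∂unitLaw = 1 - 2 * |a - b| := by
  rw [integral_sign_eq unitLaw (by fun_prop)]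
  · congr 2
    have : {x : ℝ | (a - x) * (b - x) < 0} = Set.Ioo (min a b) (max a b) := by
      ext x
      simp only [Set.mem_ofPred_eq, mul_neg_iff, Set.mem_Ioo, min_lt_iff, lt_max_iff]
      constructor
      · rintro (⟨h1, h2⟩ | ⟨h1, h2⟩)
        · exact ⟨Or.inr (by linarith), Or.inl (by linarith)⟩
        · exact ⟨Or.inl (by linarith), Or.inr (by linarith)⟩
      · rintro ⟨h1 | h1, h2 | h2⟩
        · linarith
        · exact Or.inr ⟨by linarith, by linarith⟩
        · exact Or.inl ⟨by linarith, by linarith⟩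
        · linarith
    rw [this, unitLaw_real_of_subset (le_min ha.1 hb.1) min_le_max (max_le ha.2 hb.2),
      max_sub_min_eq_abs, abs_sub_comm]
  · have h : ∀ c : ℝ, ∀ᵐ x ∂unitLaw, x ≠ c := fun c => by simp [ae_iff]
    filter_upwards [h a, h b] with x h1 h2
    exact mul_ne_zero (sub_ne_zero.2 h1.symm) (sub_ne_zero.2 h2.symm)

/-- The sign of the product over the roots is the product of the signs; by independence its mean is
(1 - 2|a - b|)^N. -/
theorem rootLaw_real_oddSplit (N : ℕ) {a b : ℝ} (ha : a ∈ Set.Icc (0 : ℝ) 1)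
    (hb : b ∈ Set.Icc (0 : ℝ) 1) : (rootLaw N).real (oddSplit N a b) = splitProb N |a - b| := by
  have h1 := integral_sign_eq (rootLaw N) (Y := fun r => rootProd r a * rootProd r b)
    ((continuous_rootProd_left a).mul (continuous_rootProd_left b)).measurable (by
      filter_upwards [ae_rootProd_ne_zero N a, ae_rootProd_ne_zero N b] with r h1 h2
      exact mul_ne_zero h1 h2)
  have h2 : ∀ r : Fin N → ℝ, ((SignType.sign (rootProd r a * rootProd r b) : SignType) : ℝ) =
      ∏ i, ((SignType.sign ((a - r i) * (b - r i)) : SignType) : ℝ) := fun r => by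
    rw [rootProd, rootProd, ← Finset.prod_mul_distrib]
    exact map_prod ((SignType.castHom : SignType →*₀ ℝ).comp (signHom : ℝ →*₀ SignType)) _ _
  simp only [h2] at h1
  rw [rootLaw, integral_fintype_prod_eq_pow
    (fun x => ((SignType.sign ((a - x) * (b - x)) : SignType) : ℝ)),
    integral_sign_unitLaw ha hb, Fintype.card_fin] at h1
  change _ = 1 - 2 * (rootLaw N).real (oddSplit N a b) at h1
  rw [splitProb, h1]
  ring

theorem rootLaw_oddSplit (N : ℕ) {a b : ℝ} (ha : a ∈ Set.Icc (0 : ℝ) 1)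
    (hb : b ∈ Set.Icc (0 : ℝ) 1) :
    rootLaw N (oddSplit N a b) = ENNReal.ofReal (splitProb N |a - b|) := by
  rw [← rootLaw_real_oddSplit N ha hb, ofReal_measureReal]

/-! ### The probability of an odd number of roots -/

theorem abs_one_sub_le {l : ℝ} (h0 : 0 ≤ l) (h1 : l ≤ 1) : |1 - 2 * l| ≤ 1 :=
  abs_le.2 ⟨by linarith, by linarith⟩

theorem splitProb_nonneg (N : ℕ) {l : ℝ} (h0 : 0 ≤ l) (h1 : l ≤ 1) : 0 ≤ splitProb N l := by
  have h := (le_abs_self _).trans ((abs_pow (1 - 2 * l) N).le.trans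
    (pow_le_one₀ (abs_nonneg _) (abs_one_sub_le h0 h1)))
  unfold splitProb; linarith

/-- Since |1 - 2l| ≤ 1, raising it to a power N ≥ 1 does not increase it. The resulting bound by the
circle distance is free of N. -/
theorem min_le_splitProb {N : ℕ} (hN : N ≠ 0) {l : ℝ} (h0 : 0 ≤ l) (h1 : l ≤ 1) :
    min l (1 - l) ≤ splitProb N l := by
  have h := (le_abs_self _).trans ((abs_pow (1 - 2 * l) N).le.trans
    (pow_le_of_le_one (abs_nonneg _) (abs_one_sub_le h0 h1) hN))
  have : |1 - 2 * l| = 1 - 2 * min l (1 - l) := by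
    rcases le_total l (1 - l) with h | h
    · rw [min_eq_left h, abs_of_nonneg (by linarith)]
    · rw [min_eq_right h, abs_of_nonpos (by linarith)]; ring
  unfold splitProb; linarith

theorem splitProb_le_of_abs {N : ℕ} {l l' : ℝ} (h : |1 - 2 * l'| ≤ 1 - 2 * l) :
    splitProb N l ≤ splitProb N l' := by
  have := (le_abs_self _).trans ((abs_pow (1 - 2 * l') N).le.trans
    (pow_le_pow_left₀ (abs_nonneg _) h N))
  unfold splitProb; linarith

theorem splitProb_le_of_abs_of_even {N : ℕ} (hN : Even N) {l l' : ℝ}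
    (h : |1 - 2 * l'| ≤ |1 - 2 * l|) : splitProb N l ≤ splitProb N l' := by
  have := pow_le_pow_left₀ (abs_nonneg _) h N
  rw [hN.pow_abs, hN.pow_abs] at this
  unfold splitProb; linarith

theorem splitProb_mono_of_odd {N : ℕ} (hN : Odd N) : Monotone (splitProb N) := by
  intro l l' h
  have := hN.strictMono_pow.monotone (show 1 - 2 * l' ≤ 1 - 2 * l by linarith)
  beta_reduce at this
  unfold splitProb; linarith

/-- From every `b` one can walk to one of four points along a path on which the probability of
disagreeing with `a` stays at least as large as at `b`. -/
theorem exists_escape (N : ℕ) {a b : ℝ} (ha : a ∈ Set.Icc (0 : ℝ) 1) (hb : b ∈ Set.Icc (0 : ℝ) 1) :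
    ∃ q ∈ ({0, 1, a + 1 / 2, a - 1 / 2} : Finset ℝ), q ∈ Set.Icc (0 : ℝ) 1 ∧
      ∀ c ∈ Set.uIcc b q, splitProb N |a - b| ≤ splitProb N |a - c| := by
  obtain ⟨ha0, ha1⟩ := ha
  obtain ⟨hb0, hb1⟩ := hb
  -- For even N the error is largest at distance 1/2 from a, so walk towards that distance, stopping
  -- at the end of the unit interval if it comes first. For odd N the error is monotone in the
  -- distance, so walk away from a to an end point.
  rcases Nat.even_or_odd N with hN | hN
  · rcases le_total a b with hab | hab
    · rcases le_total b (a + 1 / 2) with h | h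
      · rcases le_total (a + 1 / 2) 1 with h' | h'
        · refine ⟨a + 1 / 2, by simp, ⟨by linarith, h'⟩, fun c hc => ?_⟩
          rw [Set.uIcc_of_le h] at hc
          apply splitProb_le_of_abs
          rw [abs_of_nonpos (by linarith : a - b ≤ 0), abs_of_nonpos (by linarith [hc.1] : a - c ≤ 0),
            abs_of_nonneg (by linarith [hc.2])]
          linarith [hc.1]
        · refine ⟨1, by simp, by norm_num, fun c hc => ?_⟩
          rw [Set.uIcc_of_le hb1] at hc
          apply splitProb_le_of_abs
          rw [abs_of_nonpos (by linarith : a - b ≤ 0), abs_of_nonpos (by linarith [hc.1] : a - c ≤ 0),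
            abs_of_nonneg (by linarith [hc.2])]
          linarith [hc.1]
      · refine ⟨a + 1 / 2, by simp, ⟨by linarith, by linarith⟩, fun c hc => ?_⟩
        rw [Set.uIcc_of_ge h] at hc
        apply splitProb_le_of_abs_of_even hN
        rw [abs_of_nonpos (by linarith : a - b ≤ 0), abs_of_nonpos (by linarith [hc.1] : a - c ≤ 0),
          abs_of_nonpos (by linarith [hc.1]), abs_of_nonpos (by linarith)]
        linarith [hc.2]
    · rcases le_total (a - 1 / 2) b with h | h
      · rcases le_total 0 (a - 1 / 2) with h' | h'
        · refine ⟨a - 1 / 2, by simp, ⟨h', by linarith⟩, fun c hc => ?_⟩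
          rw [Set.uIcc_of_ge h] at hc
          apply splitProb_le_of_abs
          rw [abs_of_nonneg (by linarith : 0 ≤ a - b), abs_of_nonneg (by linarith [hc.2] : 0 ≤ a - c),
            abs_of_nonneg (by linarith [hc.1])]
          linarith [hc.2]
        · refine ⟨0, by simp, by norm_num, fun c hc => ?_⟩
          rw [Set.uIcc_of_ge hb0] at hc
          apply splitProb_le_of_abs
          rw [abs_of_nonneg (by linarith : 0 ≤ a - b), abs_of_nonneg (by linarith [hc.2] : 0 ≤ a - c),
            abs_of_nonneg (by linarith [hc.1])]
          linarith [hc.2]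
      · refine ⟨a - 1 / 2, by simp, ⟨by linarith, by linarith⟩, fun c hc => ?_⟩
        rw [Set.uIcc_of_le h] at hc
        apply splitProb_le_of_abs_of_even hN
        rw [abs_of_nonneg (by linarith : 0 ≤ a - b), abs_of_nonneg (by linarith [hc.2] : 0 ≤ a - c),
          abs_of_nonpos (by linarith [hc.2]), abs_of_nonpos (by linarith)]
        linarith [hc.1]
  · rcases le_total a b with hab | hab
    · refine ⟨1, by simp, by norm_num, fun c hc => splitProb_mono_of_odd hN ?_⟩
      rw [Set.uIcc_of_le hb1] at hc
      rw [abs_of_nonpos (by linarith : a - b ≤ 0), abs_of_nonpos (by linarith [hc.1] : a - c ≤ 0)]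
      linarith [hc.1]
    · refine ⟨0, by simp, by norm_num, fun c hc => splitProb_mono_of_odd hN ?_⟩
      rw [Set.uIcc_of_ge hb0] at hc
      rw [abs_of_nonneg (by linarith : 0 ≤ a - b), abs_of_nonneg (by linarith [hc.2] : 0 ≤ a - c)]
      linarith [hc.2]

/-! ### Sampled roots -/

theorem rootProd_mul_pos {N : ℕ} {r : Fin N → ℝ} {b u : ℝ} (h : ∀ i, r i ∉ Set.uIcc b u) :
    0 < rootProd r b * rootProd r u := by
  rw [rootProd, rootProd, ← Finset.prod_mul_distrib]
  refine Finset.prod_pos fun i _ => ?_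
  have hi := h i
  rw [Set.mem_uIcc] at hi
  push Not at hi
  rcases lt_trichotomy (r i) b with h1 | h1 | h1
  · have h2 : r i < u := by
      by_contra hle
      exact absurd (hi.2 (not_lt.1 hle)) (not_lt.2 h1.le)
    exact mul_pos (by linarith) (by linarith)
  · rcases le_total b u with h2 | h2
    · linarith [hi.1 h1.ge]
    · linarith [hi.2 (h1 ▸ h2)]
  · have h2 : u < r i := hi.1 h1.le
    exact mul_pos_of_neg_of_neg (by linarith) (by linarith)

theorem not_mem_oddSplit_of_pos {N : ℕ} {r : Fin N → ℝ} {a b u : ℝ} (h : r ∉ oddSplit N a b)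
    (hbu : 0 < rootProd r b * rootProd r u) : r ∉ oddSplit N a u := by
  intro hau
  apply h
  have hau' : rootProd r a * rootProd r u < 0 := hau
  have h2 : rootProd r a * rootProd r u * (rootProd r b * rootProd r u) < 0 :=
    mul_neg_of_neg_of_pos hau' hbu
  have h3 : rootProd r a * rootProd r b * (rootProd r u * rootProd r u) < 0 := by
    calc _ = _ := by ring
      _ < 0 := h2
  exact neg_of_mul_neg_left h3 (mul_self_nonneg _)

/-- If `b` is consistent with a sample, then so is the end point `q`, or else, up to the point it
comes from, a sampled root between `b` and `q`. -/
theorem exists_consistent_root_or {N n : ℕ} (w : Fin n → Fin N → ℝ) {a b q : ℝ}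
    (h : ∀ j, w j ∉ oddSplit N a b) :
    (∀ j, w j ∉ oddSplit N a q) ∨
      ∃ k i, w k i ∈ Set.uIcc b q ∧ ∀ j, w j ∉ oddSplit N a (w k i) := by
  classical
  let S : Finset (Fin n × Fin N) := Finset.univ.filter fun p => w p.1 p.2 ∈ Set.uIcc b q
  rcases S.eq_empty_or_nonempty with hS | hS
  · left
    intro j
    refine not_mem_oddSplit_of_pos (h j) (rootProd_mul_pos fun i hi => ?_)
    have : (j, i) ∈ S := by simp [S, hi]
    simp [hS] at this
  · right
    -- The sampled root nearest to b: no sampled polynomial changes sign before it.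
    obtain ⟨⟨k, i⟩, hki, hmin⟩ := S.exists_min_image (fun p => |w p.1 p.2 - b|) hS
    have hmem : w k i ∈ Set.uIcc b q := by simpa [S] using hki
    refine ⟨k, i, hmem, fun j => ?_⟩
    -- A polynomial vanishing at the candidate is consistent with it for free, because `oddSplit`
    -- asks for a strictly negative product.
    by_cases h0 : ∃ i', w j i' = w k i
    · obtain ⟨i', hi'⟩ := h0
      have : rootProd (w j) (w k i) = 0 :=
        Finset.prod_eq_zero (Finset.mem_univ i') (by rw [hi', sub_self])
      simp [oddSplit, this]
    · refine not_mem_oddSplit_of_pos (h j) (rootProd_mul_pos fun i' hi' => h0 ⟨i', ?_⟩)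
      have hsub : w j i' ∈ Set.uIcc b q := Set.uIcc_subset_uIcc_left hmem hi'
      have hle := hmin (j, i') (by simp [S, hsub])
      simp only at hle
      rcases le_total b (w k i) with hb | hb
      · rw [Set.uIcc_of_le hb] at hi'
        rw [abs_of_nonneg (by linarith), abs_of_nonneg (by linarith [hi'.1])] at hle
        linarith [hi'.2]
      · rw [Set.uIcc_of_ge hb] at hi'
        rw [abs_of_nonpos (by linarith), abs_of_nonpos (by linarith [hi'.2])] at hle
        linarith [hi'.1]

/-! ### Error of the consistent hypotheses -/

theorem lintegral_exp_neg_abs_le {c : ℝ} (hc : 0 < c) :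
    ∫⁻ x : ℝ, ENNReal.ofReal (Real.exp (-(c * |x|))) ≤ ENNReal.ofReal (2 / c) := by
  have hpt : ∀ x : ℝ, ENNReal.ofReal (Real.exp (-(c * |x|))) ≤ ENNReal.ofReal (1 / c) *
      (ProbabilityTheory.exponentialPDF c x + ProbabilityTheory.exponentialPDF c (-x)) := by
    intro x
    have key : ∀ y : ℝ, 0 ≤ y → ENNReal.ofReal (Real.exp (-(c * y))) =
        ENNReal.ofReal (1 / c) * ProbabilityTheory.exponentialPDF c y := fun y hy => by
      rw [ProbabilityTheory.exponentialPDF_eq, if_pos hy, ← ENNReal.ofReal_mul (by positivity)]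
      congr 1
      field_simp
    rcases le_total 0 x with h | h
    · rw [abs_of_nonneg h, key x h]
      gcongr
      exact le_self_add
    · rw [abs_of_nonpos h, key (-x) (by linarith)]
      gcongr
      exact le_add_self
  have hm : Measurable (ProbabilityTheory.exponentialPDF c) :=
    (ProbabilityTheory.measurable_exponentialPDFReal c).ennreal_ofReal
  calc _ ≤ _ := lintegral_mono hpt
    _ = ENNReal.ofReal (1 / c) * (1 + 1) := by
      rw [lintegral_const_mul _ (by fun_prop), lintegral_add_left hm,
        ProbabilityTheory.lintegral_exponentialPDF_eq_one hc,
        lintegral_neg_eq_self (ProbabilityTheory.exponentialPDF c),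
        ProbabilityTheory.lintegral_exponentialPDF_eq_one hc]
    _ = ENNReal.ofReal (2 / c) := by
      rw [one_add_one_eq_two, ← ENNReal.ofReal_ofNat 2, ← ENNReal.ofReal_mul (by positivity)]
      congr 1
      ring

/-- The circle distance to a is the ordinary distance to one of a, a + 1, a - 1; each of the three
translates contributes at most 2/c. -/
theorem lintegral_unitLaw_exp_min_le {a c : ℝ} (ha : a ∈ Set.Icc (0 : ℝ) 1) (hc : 0 < c) :
    ∫⁻ u, ENNReal.ofReal (Real.exp (-(c * min |a - u| (1 - |a - u|)))) ∂unitLaw ≤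
      ENNReal.ofReal (6 / c) := by
  let F : ℝ → ℝ≥0∞ := fun x => ENNReal.ofReal (Real.exp (-(c * |x|)))
  have hF : Measurable F := by fun_prop
  have hpt : ∀ u ∈ Set.Ioo (0 : ℝ) 1,
      ENNReal.ofReal (Real.exp (-(c * min |a - u| (1 - |a - u|)))) ≤
      F (u - a) + F (u - (a + 1)) + F (u - (a - 1)) := by
    rintro u ⟨hu0, hu1⟩
    obtain ⟨ha0, ha1⟩ := ha
    rcases min_choice |a - u| (1 - |a - u|) with h | h
    · rw [h, abs_sub_comm]
      exact le_self_add.trans le_self_add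
    · rw [h]
      rcases le_total a u with h' | h'
      · refine le_trans (le_of_eq ?_) (le_add_self.trans le_self_add)
        simp only [F]
        rw [abs_of_nonpos (by linarith : a - u ≤ 0), abs_of_nonpos (by linarith)]
        ring_nf
      · refine le_trans (le_of_eq ?_) le_add_self
        simp only [F]
        rw [abs_of_nonneg (by linarith : 0 ≤ a - u), abs_of_nonneg (by linarith)]
        ring_nf
  calc _ ≤ ∫⁻ u, (F (u - a) + F (u - (a + 1)) + F (u - (a - 1))) :=
        (setLIntegral_mono' measurableSet_Ioo hpt).trans (setLIntegral_le_lintegral _ _)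
    _ ≤ ENNReal.ofReal (2 / c) + ENNReal.ofReal (2 / c) + ENNReal.ofReal (2 / c) := by
      rw [lintegral_add_left (by fun_prop), lintegral_add_left (by fun_prop),
        lintegral_sub_right_eq_self F, lintegral_sub_right_eq_self F,
        lintegral_sub_right_eq_self F]
      have := lintegral_exp_neg_abs_le hc
      gcongr
    _ = ENNReal.ofReal (6 / c) := by
      rw [← ENNReal.ofReal_add (by positivity) (by positivity),
        ← ENNReal.ofReal_add (by positivity) (by positivity)]
      congr 1
      ring

theorem rootLaw_compl_oddSplit_le (N : ℕ) {a b : ℝ} (ha : a ∈ Set.Icc (0 : ℝ) 1)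
    (hb : b ∈ Set.Icc (0 : ℝ) 1) :
    rootLaw N (oddSplit N a b)ᶜ ≤ ENNReal.ofReal (Real.exp (-splitProb N |a - b|)) := by
  have hl : |a - b| ≤ 1 := abs_le.2 ⟨by linarith [ha.1, hb.2], by linarith [ha.2, hb.1]⟩
  rw [prob_compl_eq_one_sub (measurableSet_oddSplit N a b), rootLaw_oddSplit N ha hb,
    ← ENNReal.ofReal_one, ← ENNReal.ofReal_sub _ (splitProb_nonneg N (abs_nonneg _) hl)]
  refine ENNReal.ofReal_le_ofReal ?_
  have := Real.add_one_le_exp (-splitProb N |a - b|)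
  linarith

theorem pi_forall_not_oddSplit_le (N n : ℕ) {a b : ℝ} (ha : a ∈ Set.Icc (0 : ℝ) 1)
    (hb : b ∈ Set.Icc (0 : ℝ) 1) :
    Measure.pi (fun _ : Fin n => rootLaw N) {w | ∀ j, w j ∉ oddSplit N a b} ≤
      ENNReal.ofReal (Real.exp (-(n * splitProb N |a - b|))) := by
  have : {w : Fin n → Fin N → ℝ | ∀ j, w j ∉ oddSplit N a b} =
      Set.univ.pi fun _ => (oddSplit N a b)ᶜ := by
    ext w; simp
  rw [this, Measure.pi_pi, Finset.prod_const, Finset.card_univ, Fintype.card_fin]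
  refine (pow_le_pow_left' (rootLaw_compl_oddSplit_le N ha hb) n).trans (le_of_eq ?_)
  rw [← ENNReal.ofReal_pow (Real.exp_nonneg _), ← Real.exp_nat_mul, mul_neg]

theorem measurable_splitProb (N : ℕ) : Measurable (splitProb N) := by
  unfold splitProb; fun_prop

/-- A sampled root that disagrees often with `a` is unlikely to be consistent with the rest of the
sample. -/
theorem pi_root_consistent_le {N n : ℕ} (hn : n ≠ 0) (k : Fin (n + 1)) (i : Fin N) {a r : ℝ}
    (ha : a ∈ Set.Icc (0 : ℝ) 1) :
    Measure.pi (fun _ : Fin (n + 1) => rootLaw N)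
      {w | w k i ∈ Set.Icc (0 : ℝ) 1 ∧ r < splitProb N |a - w k i| ∧
        ∀ j, w (k.succAbove j) ∉ oddSplit N a (w k i)} ≤
      ENNReal.ofReal (12 / n * Real.exp (-(n * r / 2))) := by
  have hN : N ≠ 0 := by rintro rfl; exact i.elim0
  let B : Set ((Fin N → ℝ) × (Fin n → Fin N → ℝ)) :=
    {p | p.1 i ∈ Set.Icc (0 : ℝ) 1 ∧ r < splitProb N |a - p.1 i| ∧
      ∀ j, p.2 j ∉ oddSplit N a (p.1 i)}
  have hB : MeasurableSet B := by
    have h1 : MeasurableSet {p : (Fin N → ℝ) × (Fin n → Fin N → ℝ) | p.1 i ∈ Set.Icc (0 : ℝ) 1} :=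
      measurableSet_Icc.preimage (by fun_prop : Measurable fun p :
        (Fin N → ℝ) × (Fin n → Fin N → ℝ) => p.1 i)
    have h2 : MeasurableSet {p : (Fin N → ℝ) × (Fin n → Fin N → ℝ) |
        r < splitProb N |a - p.1 i|} :=
      measurableSet_lt measurable_const ((measurable_splitProb N).comp (by fun_prop))
    have h3 : MeasurableSet {p : (Fin N → ℝ) × (Fin n → Fin N → ℝ) |
        ∀ j, p.2 j ∉ oddSplit N a (p.1 i)} := by
      simp only [Set.ofPred_forall]
      refine MeasurableSet.iInter fun j => MeasurableSet.compl ?_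
      simp only [oddSplit, rootProd]
      exact measurableSet_lt (by fun_prop) measurable_const
    exact h1.inter (h2.inter h3)
  have hpre : {w : Fin (n + 1) → Fin N → ℝ | w k i ∈ Set.Icc (0 : ℝ) 1 ∧
      r < splitProb N |a - w k i| ∧ ∀ j, w (k.succAbove j) ∉ oddSplit N a (w k i)} =
      MeasurableEquiv.piFinSuccAbove (fun _ => Fin N → ℝ) k ⁻¹' B := by
    ext w
    rfl
  -- The k-th root tuple is independent of the remaining samples: condition on it and apply Fubini.
  rw [hpre, (measurePreserving_piFinSuccAbove (fun _ : Fin (n + 1) => rootLaw N)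
    k).measure_preimage_equiv, Measure.prod_apply hB]
  have hn' : (0 : ℝ) < n := by positivity
  have hsec : ∀ x : Fin N → ℝ,
      Measure.pi (fun _ : Fin n => rootLaw N) (Prod.mk x ⁻¹' B) ≤
        ENNReal.ofReal (Real.exp (-(n * r / 2))) * ENNReal.ofReal
          (Real.exp (-(n / 2 * min |a - x i| (1 - |a - x i|)))) := by
    intro x
    by_cases hx : x i ∈ Set.Icc (0 : ℝ) 1 ∧ r < splitProb N |a - x i|
    · have hl : |a - x i| ≤ 1 :=
        abs_le.2 ⟨by linarith [ha.1, hx.1.2], by linarith [ha.2, hx.1.1]⟩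
      calc _ ≤ Measure.pi (fun _ : Fin n => rootLaw N) {w | ∀ j, w j ∉ oddSplit N a (x i)} :=
            measure_mono fun w hw => hw.2.2
        _ ≤ _ := pi_forall_not_oddSplit_le N n ha hx.1
        _ ≤ _ := by
          rw [← ENNReal.ofReal_mul (Real.exp_nonneg _), ← Real.exp_add]
          refine ENNReal.ofReal_le_ofReal (Real.exp_le_exp.2 ?_)
          -- The exponent is split in halves: one is bounded through r and gives the decay, the
          -- other through the circle distance and gives the factor of order 1/n after integration.
          have h1 := mul_le_mul_of_nonneg_left (min_le_splitProb hN (abs_nonneg _) hl) hn'.le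
          have h2 := mul_le_mul_of_nonneg_left hx.2.le hn'.le
          linarith
    · have : Prod.mk x ⁻¹' B = ∅ := by
        ext w
        simp only [Set.mem_preimage, Set.mem_empty_iff_false, iff_false]
        exact fun h => hx ⟨h.1, h.2.1⟩
      simp [this]
  refine (lintegral_mono hsec).trans ?_
  have heval : MeasurePreserving (fun x : Fin N → ℝ => x i) (rootLaw N) unitLaw :=
    measurePreserving_eval (fun _ : Fin N => unitLaw) i
  rw [lintegral_const_mul _ (by fun_prop), heval.lintegral_comp (f := fun u => ENNReal.ofReal
      (Real.exp (-(n / 2 * min |a - u| (1 - |a - u|))))) (by fun_prop), mul_comm,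
    ENNReal.ofReal_mul (by positivity)]
  gcongr
  refine (lintegral_unitLaw_exp_min_le ha (by positivity)).trans (le_of_eq ?_)
  congr 1
  field_simp
  norm_num

/-- With high probability, every hypothesis consistent with the sample has small error. -/
theorem pi_exists_consistent_le {N n : ℕ} (hn : n ≠ 0) {a r : ℝ}
    (ha : a ∈ Set.Icc (0 : ℝ) 1) (hr : 0 ≤ r) :
    Measure.pi (fun _ : Fin (n + 1) => rootLaw N)
      {w | ∃ b ∈ Set.Icc (0 : ℝ) 1, r < splitProb N |a - b| ∧ ∀ j, w j ∉ oddSplit N a b} ≤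
      ENNReal.ofReal ((24 * N + 4) * Real.exp (-(n * r / 2))) := by
  classical
  let ν := Measure.pi (fun _ : Fin (n + 1) => rootLaw N)
  let Q : Finset ℝ := ({0, 1, a + 1 / 2, a - 1 / 2} : Finset ℝ).filter
    fun q => q ∈ Set.Icc (0 : ℝ) 1 ∧ r < splitProb N |a - q|
  let E : Fin (n + 1) → Fin N → Set (Fin (n + 1) → Fin N → ℝ) := fun k i =>
    {w | w k i ∈ Set.Icc (0 : ℝ) 1 ∧ r < splitProb N |a - w k i| ∧
        ∀ j, w (k.succAbove j) ∉ oddSplit N a (w k i)}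
  have hsub : {w : Fin (n + 1) → Fin N → ℝ | ∃ b ∈ Set.Icc (0 : ℝ) 1, r < splitProb N |a - b| ∧
      ∀ j, w j ∉ oddSplit N a b} ⊆
      (⋃ q ∈ Q, {w | ∀ j, w j ∉ oddSplit N a q}) ∪ ⋃ k ∈ Finset.univ, ⋃ i ∈ Finset.univ, E k i := by
    rintro w ⟨b, hb, hrb, hw⟩
    obtain ⟨q, hq, hq01, hpath⟩ := exists_escape N ha hb
    rcases exists_consistent_root_or w (q := q) hw with h | ⟨k, i, hki, h⟩
    · refine Or.inl (Set.mem_biUnion (x := q) ?_ h)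
      exact Finset.mem_filter.2 ⟨hq, hq01, hrb.trans_le (hpath q Set.right_mem_uIcc)⟩
    · refine Or.inr ?_
      simp only [Set.mem_iUnion]
      exact ⟨k, Finset.mem_univ _, i, Finset.mem_univ _, Set.uIcc_subset_Icc hb hq01 hki,
        hrb.trans_le (hpath _ hki), fun j => h _⟩
  have hn' : (1 : ℝ) ≤ n := by exact_mod_cast Nat.one_le_iff_ne_zero.2 hn
  have hcard : (Q.card : ℝ) ≤ 4 := by
    exact_mod_cast (Finset.card_filter_le _ _).trans Finset.card_le_four
  set e := Real.exp (-(n * r / 2)) with he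
  have h1 : ν (⋃ q ∈ Q, {w | ∀ j, w j ∉ oddSplit N a q}) ≤ ENNReal.ofReal (4 * e) := by
    calc _ ≤ ∑ q ∈ Q, ν {w | ∀ j, w j ∉ oddSplit N a q} := measure_biUnion_finset_le _ _
      _ ≤ ∑ q ∈ Q, ENNReal.ofReal e := by
        refine Finset.sum_le_sum fun q hq => ?_
        obtain ⟨-, hq01, hrq⟩ := Finset.mem_filter.1 hq
        refine (pi_forall_not_oddSplit_le N (n + 1) ha hq01).trans
          (ENNReal.ofReal_le_ofReal (Real.exp_le_exp.2 ?_))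
        push_cast
        have := mul_le_mul_of_nonneg_left hrq.le (by positivity : (0 : ℝ) ≤ n + 1)
        nlinarith
      _ ≤ _ := by
        rw [← ENNReal.ofReal_sum_of_nonneg fun _ _ => Real.exp_nonneg _, Finset.sum_const,
          nsmul_eq_mul]
        gcongr
  have h2 : ν (⋃ k ∈ Finset.univ, ⋃ i ∈ Finset.univ, E k i) ≤ ENNReal.ofReal (24 * N * e) := by
    calc _ ≤ ∑ k, ν (⋃ i ∈ Finset.univ, E k i) := measure_biUnion_finset_le _ _
      _ ≤ ∑ k, ∑ i, ν (E k i) := Finset.sum_le_sum fun k _ => measure_biUnion_finset_le _ _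
      _ ≤ ∑ _k : Fin (n + 1), ∑ _i : Fin N, ENNReal.ofReal (12 / n * e) :=
        Finset.sum_le_sum fun k _ => Finset.sum_le_sum fun i _ => pi_root_consistent_le hn k i ha
      _ ≤ _ := by
        rw [Finset.sum_const, Finset.sum_const, Finset.card_univ, Finset.card_univ,
          Fintype.card_fin, Fintype.card_fin, nsmul_eq_mul, nsmul_eq_mul, ← mul_assoc,
          ← Nat.cast_mul, ← ENNReal.ofReal_natCast, ← ENNReal.ofReal_mul (by positivity)]
        refine ENNReal.ofReal_le_ofReal ?_
        -- The union over n + 1 samples meets the factor 12/n, so only 24N remains.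
        have h3 : ((n + 1 : ℕ) : ℝ) / n ≤ 2 := by
          rw [div_le_iff₀ (by linarith)]; push_cast; linarith
        calc (((n + 1) * N : ℕ) : ℝ) * (12 / n * e) = ((n + 1 : ℕ) : ℝ) / n * (12 * N * e) := by
              push_cast; ring
          _ ≤ 2 * (12 * N * e) := by gcongr
          _ = _ := by ring
  calc _ ≤ _ := measure_mono hsub
    _ ≤ _ := measure_union_le _ _
    _ ≤ _ := add_le_add h1 h2
    _ = _ := by
      rw [← ENNReal.ofReal_add (by positivity) (by positivity)]
      congr 1
      ring

/-! ### Independent samples -/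

section Sampling

variable {X : Type*} [MeasurableSpace X]

theorem measurePreserving_initial (ν : Measure X) [IsProbabilityMeasure ν] (n : ℕ) :
    MeasurePreserving (fun (w : ℕ → X) (j : Fin n) => w j) (Measure.infinitePi fun _ => ν)
      (Measure.pi fun _ => ν) := by
  have hm : Measurable fun (w : ℕ → X) (j : Fin n) => w j := by fun_prop
  refine ⟨hm, (Measure.pi_eq fun s hs => ?_).symm⟩
  rw [Measure.map_apply hm (MeasurableSet.univ_pi hs)]
  classical
  let t : ℕ → Set X := fun i => if h : i < n then s ⟨i, h⟩ else Set.univ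
  have ht : (fun (w : ℕ → X) (j : Fin n) => w j) ⁻¹' Set.univ.pi s =
      (↑(Finset.range n) : Set ℕ).pi t := by
    ext w
    simp only [Set.mem_preimage, Set.mem_pi, Set.mem_univ, true_implies, Finset.coe_range,
      Set.mem_Iio, t]
    constructor
    · intro h i hi
      rw [dif_pos hi]
      exact h ⟨i, hi⟩
    · intro h j
      have := h j j.2
      rwa [dif_pos j.2] at this
  rw [ht, Measure.infinitePi_pi]
  · rw [← Fin.prod_univ_eq_prod_range (fun i => ν (t i)) n]
    refine Finset.prod_congr rfl fun j _ => ?_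
    simp [t]
  · intro i hi
    have hi' : i < n := Finset.mem_range.1 hi
    simp only [t, dif_pos hi']
    exact hs _

/-- Pushforward dominates the measure of the preimage for every set, which suffices here because the
failure events need not be shown measurable. -/
theorem infinitePi_initial_le (ν : Measure X) [IsProbabilityMeasure ν] (n : ℕ)
    (S : Set (Fin n → X)) :
    Measure.infinitePi (fun _ : ℕ => ν) {w | (fun j : Fin n => w j) ∈ S} ≤
      Measure.pi (fun _ => ν) S := by
  have h := measurePreserving_initial ν n
  rw [← h.map_eq]
  exact Measure.le_map_apply h.measurable.aemeasurable S

open Classical in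
/-- A Chernoff bound for the number of successes in independent trials. -/
theorem pi_count_ge_le (ν : Measure X) [IsProbabilityMeasure ν] {n : ℕ} {W : Fin n → Set X}
    (hW : ∀ j, MeasurableSet (W j)) (M : ℕ) :
    (Measure.pi fun _ : Fin n => ν).real
      {w | M ≤ (Finset.univ.filter fun j => w j ∈ W j).card} ≤
      (∏ j, (1 + ν.real (W j))) / 2 ^ M := by
  -- The product of these factors is 2 to the number of successes; Markov's inequality is applied to
  -- it at level 2^M.
  let f : Fin n → X → ℝ := fun j x => 1 + (W j).indicator (fun _ => (1 : ℝ)) x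
  have hf : ∀ j, Integrable (f j) ν := fun j =>
    (integrable_const _).add ((integrable_const _).indicator (hW j))
  have hprod : ∀ w : Fin n → X, ∏ j, f j (w j) =
      2 ^ (Finset.univ.filter fun j => w j ∈ W j).card := fun w => by
    rw [← Finset.prod_const, Finset.prod_filter]
    refine Finset.prod_congr rfl fun j _ => ?_
    by_cases h : w j ∈ W j <;> simp [f, h]
    norm_num
  have hint : Integrable (fun w : Fin n → X => ∏ j, f j (w j)) (Measure.pi fun _ => ν) :=
    Integrable.fintype_prod hf
  have hmarkov := mul_meas_ge_le_integral_of_nonneg (μ := Measure.pi fun _ : Fin n => ν)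
    (Filter.Eventually.of_forall fun w => by rw [hprod]; positivity) hint (2 ^ M)
  rw [integral_fintype_prod_eq_prod] at hmarkov
  have hval : ∀ j, ∫ x, f j x ∂ν = 1 + ν.real (W j) := fun j => by
    rw [integral_add (integrable_const _) ((integrable_const _).indicator (hW j)),
      integral_indicator_const _ (hW j)]
    simp
  simp only [hval, hprod] at hmarkov
  rw [le_div_iff₀ (by positivity), mul_comm]
  refine le_trans (le_of_eq ?_) hmarkov
  congr 2
  ext w
  exact (pow_le_pow_iff_right₀ (by norm_num : (1 : ℝ) < 2)).symm

end Sampling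

/-! ### The distribution on pairs of plans -/

/-- The coefficient vector of the monic polynomial with roots `r`. -/
noncomputable def rootCoeff (T : ℕ) (r : Fin (T - 1) → ℝ) : Plan T :=
  fun t => (∏ i : Fin (T - 1), (Polynomial.X - Polynomial.C (r i))).coeff (t : ℕ)

/-- The root tuple `r`, extended by zero to a plan. -/
def rootPad (T : ℕ) (r : Fin (T - 1) → ℝ) : Plan T :=
  fun t => if h : (t : ℕ) < T - 1 then r ⟨t, h⟩ else 0

/-- A pair of plans whose difference is the coefficient vector of the polynomial with roots `r`;
the second plan records `r`, which makes the map injective. -/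
noncomputable def planPair (T : ℕ) (r : Fin (T - 1) → ℝ) : Plan T × Plan T :=
  (rootCoeff T r + rootPad T r, rootPad T r)

theorem continuous_coeff_prod_X_sub_C {ι : Type*} (s : Finset ι) (n : ℕ) :
    Continuous fun r : ι → ℝ => (∏ i ∈ s, (Polynomial.X - Polynomial.C (r i))).coeff n := by
  classical
  induction s using Finset.induction_on generalizing n with
  | empty => simpa using continuous_const
  | insert i s hi ih =>
    simp only [Finset.prod_insert hi, sub_mul, Polynomial.coeff_sub, Polynomial.coeff_C_mul]
    refine Continuous.sub ?_ ((continuous_apply i).mul (ih n))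
    cases n with
    | zero => simpa using continuous_const
    | succ n => simpa only [Polynomial.coeff_X_mul] using ih n

theorem continuous_planPair (T : ℕ) : Continuous (planPair T) := by
  have h1 : Continuous (rootCoeff T) :=
    continuous_pi fun t => continuous_coeff_prod_X_sub_C Finset.univ t
  have h2 : Continuous (rootPad T) := by
    refine continuous_pi fun t => ?_
    by_cases h : (t : ℕ) < T - 1
    · simpa only [rootPad, dif_pos h] using continuous_apply _
    · simpa only [rootPad, dif_neg h] using continuous_const
  exact (h1.add h2).prodMk h2

theorem injective_planPair (T : ℕ) : Function.Injective (planPair T) := by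
  intro r r' h
  have h2 : rootPad T r = rootPad T r' := congrArg Prod.snd h
  funext i
  have := congrFun h2 ⟨i, by omega⟩
  simpa [rootPad] using this

/-- Lets arbitrary sets be measured by their preimages. This matters because `disRegion` is an
uncountable union. -/
theorem measurableEmbedding_planPair (T : ℕ) : MeasurableEmbedding (planPair T) :=
  (continuous_planPair T).measurableEmbedding (injective_planPair T)

/-- The recorded roots cancel, and the discounted value of the difference is b·p(b) with b > 0. -/
theorem planPair_mem_edPref_iff {T : ℕ} (hT : 2 ≤ T) (r : Fin (T - 1) → ℝ) {b : ℝ} (hb : 0 < b) :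
    planPair T r ∈ edPref T b ↔ 0 ≤ rootProd r b := by
  have hdeg : (∏ i : Fin (T - 1), (Polynomial.X - Polynomial.C (r i))).natDegree < T := by
    rw [Polynomial.natDegree_finsetProd_X_sub_C_eq_card, Finset.card_univ, Fintype.card_fin]
    omega
  have heval : rootProd r b = ∑ i : Fin T, rootCoeff T r i * b ^ (i : ℕ) := by
    have h := Polynomial.eval_eq_sum_range' hdeg b
    rw [Polynomial.eval_prod] at h
    simp only [Polynomial.eval_sub, Polynomial.eval_X, Polynomial.eval_C] at h
    rw [rootProd, h]
    exact (Fin.sum_univ_eq_sum_range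
      (fun k => (∏ i : Fin (T - 1), (Polynomial.X - Polynomial.C (r i))).coeff k * b ^ k) T).symm
  have hsum : ∑ i : Fin T, b ^ ((i : ℕ) + 1) * (rootCoeff T r + rootPad T r) i =
      b * rootProd r b + ∑ i : Fin T, b ^ ((i : ℕ) + 1) * rootPad T r i := by
    rw [heval, Finset.mul_sum, ← Finset.sum_add_distrib]
    refine Finset.sum_congr rfl fun i _ => ?_
    rw [Pi.add_apply]
    ring
  change ∑ i : Fin T, b ^ ((i : ℕ) + 1) * rootPad T r i ≤
    ∑ i : Fin T, b ^ ((i : ℕ) + 1) * (rootCoeff T r + rootPad T r) i ↔ _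
  rw [hsum, le_add_iff_nonneg_left, mul_nonneg_iff_of_pos_left hb]

/-- The law of `planPair T r` for independent uniform roots `r`. -/
noncomputable def planLaw (T : ℕ) : Measure (Plan T × Plan T) :=
  (rootLaw (T - 1)).map (planPair T)

instance isProbabilityMeasure_planLaw (T : ℕ) : IsProbabilityMeasure (planLaw T) :=
  Measure.isProbabilityMeasure_map (continuous_planPair T).measurable.aemeasurable

theorem planLaw_apply (T : ℕ) (S : Set (Plan T × Plan T)) :
    planLaw T S = rootLaw (T - 1) (planPair T ⁻¹' S) :=
  (measurableEmbedding_planPair T).map_apply _ _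

theorem map_diffClass_planLaw (T : ℕ) : (planLaw T).map (diffClass T) = rootClassLaw T := by
  have hm : Measurable (diffClass T) :=
    measurable_quotient_mk''.comp (measurable_fst.sub measurable_snd)
  rw [planLaw, Measure.map_map hm (continuous_planPair T).measurable, rootClassLaw,
    ← rootLaw_eq_restrict]
  congr 1
  funext r
  simp only [Function.comp_apply, diffClass, planPair, add_sub_cancel_right]
  rfl

theorem infinitePi_planLaw_apply (T : ℕ) (S : Set (ℕ → Plan T × Plan T)) :
    Measure.infinitePi (fun _ => planLaw T) S =
      Measure.infinitePi (fun _ : ℕ => rootLaw (T - 1)) {w | (fun k => planPair T (w k)) ∈ S} := by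
  have h := Measure.infinitePi_map_pi (fun _ : ℕ => rootLaw (T - 1))
    (f := fun _ => planPair T) fun _ => (continuous_planPair T).measurable
  change _ = Measure.infinitePi fun _ => planLaw T at h
  have hemb : MeasurableEmbedding
      fun (w : ℕ → Fin (T - 1) → ℝ) (k : ℕ) => planPair T (w k) :=
    (continuous_pi fun k => (continuous_planPair T).comp (continuous_apply k)).measurableEmbedding
      fun w w' hw => funext fun k => injective_planPair T (congrFun hw k)
  rw [← h, hemb.map_apply]
  rfl

/-! ### Disagreement between discount factors -/

theorem rootProd_nonneg_iff_of_pos {N : ℕ} {r : Fin N → ℝ} {a b : ℝ}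
    (h : 0 < rootProd r a * rootProd r b) : 0 ≤ rootProd r a ↔ 0 ≤ rootProd r b := by
  rcases mul_pos_iff.1 h with ⟨h1, h2⟩ | ⟨h1, h2⟩
  · exact iff_of_true h1.le h2.le
  · exact iff_of_false h1.not_ge h2.not_ge

theorem not_mem_oddSplit_of_iff {N : ℕ} {r : Fin N → ℝ} {a b : ℝ}
    (h : 0 ≤ rootProd r a ↔ 0 ≤ rootProd r b) : r ∉ oddSplit N a b := by
  intro hr
  rcases mul_neg_iff.1 (show rootProd r a * rootProd r b < 0 from hr) with ⟨h1, h2⟩ | ⟨h1, h2⟩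
  · exact h2.not_ge (h.1 h1.le)
  · exact h1.not_ge (h.2 h2.le)

theorem mem_symmDiff_iff_not_iff {α : Type*} {h h' : Set α} {z : α} :
    z ∈ symmDiff h h' ↔ ¬(z ∈ h ↔ z ∈ h') := by
  rw [Set.mem_symmDiff]; tauto

/-- The weak labels and the strict sign change differ only when a or b is itself a root, a null
event. -/
theorem planLaw_symmDiff {T : ℕ} (hT : 2 ≤ T) {a b : ℝ} (ha : a ∈ Set.Ioo (0 : ℝ) 1)
    (hb : b ∈ Set.Ioo (0 : ℝ) 1) :
    planLaw T (symmDiff (edPref T a) (edPref T b)) =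
      ENNReal.ofReal (splitProb (T - 1) |a - b|) := by
  rw [← rootLaw_oddSplit (T - 1) (Set.Ioo_subset_Icc_self ha) (Set.Ioo_subset_Icc_self hb),
    planLaw_apply]
  refine measure_congr ?_
  filter_upwards [ae_rootProd_ne_zero (T - 1) a, ae_rootProd_ne_zero (T - 1) b] with r h1 h2
  refine propext ?_
  change planPair T r ∈ symmDiff (edPref T a) (edPref T b) ↔ r ∈ oddSplit (T - 1) a b
  rw [mem_symmDiff_iff_not_iff, planPair_mem_edPref_iff hT r ha.1,
    planPair_mem_edPref_iff hT r hb.1]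
  constructor
  · intro h
    by_contra hr
    have h3 : 0 < rootProd r a * rootProd r b :=
      lt_of_le_of_ne (not_lt.1 hr) (mul_ne_zero h1 h2).symm
    exact h (rootProd_nonneg_iff_of_pos h3)
  · exact fun h h' => not_mem_oddSplit_of_iff h' h

theorem mem_prefBall_iff {T : ℕ} (hT : 2 ≤ T) {a R : ℝ} (ha : a ∈ Set.Ioo (0 : ℝ) 1)
    (hR : 0 ≤ R) (h : Set (Plan T × Plan T)) :
    h ∈ prefBall (planLaw T) (edModel T) (edPref T a) R ↔
      ∃ b ∈ Set.Ioo (0 : ℝ) 1, h = edPref T b ∧ splitProb (T - 1) |a - b| ≤ R := by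
  constructor
  · rintro ⟨⟨b, hb0, hb1, rfl⟩, hle⟩
    rw [planLaw_symmDiff hT ha ⟨hb0, hb1⟩, ENNReal.ofReal_le_ofReal_iff hR] at hle
    exact ⟨b, ⟨hb0, hb1⟩, rfl, hle⟩
  · rintro ⟨b, hb, rfl, hle⟩
    refine ⟨⟨b, hb.1, hb.2, rfl⟩, ?_⟩
    rw [planLaw_symmDiff hT ha hb]
    exact ENNReal.ofReal_le_ofReal hle

/-! ### The disagreement coefficient -/

/-- The points of `(0, 1)` whose distance from `a` on the circle `ℝ / ℤ` exceeds `l`. -/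
def farSet (a l : ℝ) : Set ℝ := {x | x ∈ Set.Ioo (0 : ℝ) 1 ∧ l < |x - a| ∧ |x - a| < 1 - l}

theorem measurableSet_farSet (a l : ℝ) : MeasurableSet (farSet a l) :=
  have h : Measurable fun x : ℝ => |x - a| := by fun_prop
  measurableSet_Ioo.inter ((measurableSet_lt measurable_const h).inter
    (measurableSet_lt h measurable_const))

/-- The removed arc around a has length 2l on the circle; the cases record whether it wraps past 0,
past 1, or neither. -/
theorem le_unitLaw_farSet {a l : ℝ} (ha : a ∈ Set.Icc (0 : ℝ) 1) (h0 : 0 ≤ l) (h1 : l ≤ 1 / 2) :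
    1 - 2 * l ≤ unitLaw.real (farSet a l) := by
  obtain ⟨ha0, ha1⟩ := ha
  rcases lt_or_ge a l with h | h
  · have hsub : Set.Ioo (a + l) (1 + a - l) ⊆ farSet a l := by
      rintro x ⟨hx0, hx1⟩
      refine ⟨⟨by linarith, by linarith⟩, ?_⟩
      rw [abs_of_nonneg (by linarith)]
      exact ⟨by linarith, by linarith⟩
    refine le_trans (le_of_eq ?_) (measureReal_mono hsub)
    rw [unitLaw_real_of_subset (by linarith) (by linarith) (by linarith)]
    ring
  rcases lt_or_ge (1 - l) a with h' | h'
  · have hsub : Set.Ioo (a + l - 1) (a - l) ⊆ farSet a l := by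
      rintro x ⟨hx0, hx1⟩
      refine ⟨⟨by linarith, by linarith⟩, ?_⟩
      rw [abs_of_nonpos (by linarith)]
      exact ⟨by linarith, by linarith⟩
    refine le_trans (le_of_eq ?_) (measureReal_mono hsub)
    rw [unitLaw_real_of_subset (by linarith) (by linarith) (by linarith)]
    ring
  · have hsub : Set.Ioo 0 (a - l) ∪ Set.Ioo (a + l) 1 ⊆ farSet a l := by
      rintro x (⟨hx0, hx1⟩ | ⟨hx0, hx1⟩)
      · refine ⟨⟨by linarith, by linarith⟩, ?_⟩
        rw [abs_of_nonpos (by linarith)]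
        exact ⟨by linarith, by linarith⟩
      · refine ⟨⟨by linarith, by linarith⟩, ?_⟩
        rw [abs_of_nonneg (by linarith)]
        exact ⟨by linarith, by linarith⟩
    have hdisj : Disjoint (Set.Ioo 0 (a - l)) (Set.Ioo (a + l) 1) :=
      Set.disjoint_left.2 fun x hx hx' => by linarith [hx.2, hx'.1]
    refine le_trans (le_of_eq ?_) (measureReal_mono hsub)
    rw [measureReal_union hdisj measurableSet_Ioo,
      unitLaw_real_of_subset le_rfl (by linarith) (by linarith),
      unitLaw_real_of_subset (by linarith) (by linarith) le_rfl]
    ring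

/-- For N ≥ 1, the error comparison forces |a - b| ≤ l, or N even and |a - b| ≥ 1 - l. In the first
case no root separates a from b; in the second all of them do, and their number is even. -/
theorem rootProd_mul_pos_of_farSet {N : ℕ} {r : Fin N → ℝ} {a b l : ℝ}
    (hb : b ∈ Set.Ioo (0 : ℝ) 1) (h0 : 0 ≤ l) (h1 : l ≤ 1 / 2)
    (hr : ∀ i, r i ∈ farSet a l) (hab : splitProb N |a - b| ≤ splitProb N l) :
    0 < rootProd r a * rootProd r b := by
  rw [rootProd, rootProd, ← Finset.prod_mul_distrib]
  rcases eq_or_ne N 0 with rfl | hN0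
  · simp
  have hpow : (1 - 2 * l) ^ N ≤ (1 - 2 * |a - b|) ^ N := by
    unfold splitProb at hab; linarith
  have hcase : |a - b| ≤ l ∨ Even N ∧ 1 - l ≤ |a - b| := by
    rcases Nat.even_or_odd N with hN | hN
    · rw [← hN.pow_abs, ← hN.pow_abs (1 - 2 * |a - b|),
        pow_le_pow_iff_left₀ (abs_nonneg _) (abs_nonneg _) hN0,
        abs_of_nonneg (by linarith : 0 ≤ 1 - 2 * l), le_abs] at hpow
      rcases hpow with h | h
      · exact Or.inl (by linarith)
      · exact Or.inr ⟨hN, by linarith⟩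
    · have := hN.strictMono_pow.le_iff_le.1 hpow
      exact Or.inl (by linarith)
  rcases hcase with h | ⟨hN, h⟩
  · refine Finset.prod_pos fun i _ => ?_
    obtain ⟨-, h2, -⟩ := hr i
    obtain ⟨h3, h4⟩ := abs_le.1 h
    rcases lt_abs.1 h2 with h5 | h5
    · exact mul_pos_of_neg_of_neg (by linarith) (by linarith)
    · exact mul_pos (by linarith) (by linarith)
  · have hneg : ∀ i, (a - r i) * (b - r i) < 0 := by
      intro i
      obtain ⟨⟨h2, h3⟩, h4, h5⟩ := hr i
      obtain ⟨h6, h7⟩ := abs_lt.1 h5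
      rcases le_abs.1 h with h8 | h8 <;> rcases lt_abs.1 h4 with h9 | h9
      · linarith [hb.1]
      · exact mul_neg_of_pos_of_neg (by linarith) (by linarith)
      · exact mul_neg_of_neg_of_pos (by linarith) (by linarith)
      · linarith [hb.2]
    have hprod : ∏ i, (a - r i) * (b - r i) = ∏ i, -((a - r i) * (b - r i)) := by
      rw [Finset.prod_neg, Finset.card_univ, Fintype.card_fin, hN.neg_one_pow, one_mul]
    rw [hprod]
    exact Finset.prod_pos fun i _ => neg_pos.2 (hneg i)

theorem rootLaw_compl_pi (N : ℕ) {O : Set ℝ} (hO : MeasurableSet O) :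
    rootLaw N (Set.univ.pi fun _ : Fin N => O)ᶜ = ENNReal.ofReal (1 - unitLaw.real O ^ N) := by
  have h1 : rootLaw N (Set.univ.pi fun _ : Fin N => O) = ENNReal.ofReal (unitLaw.real O ^ N) := by
    rw [rootLaw, Measure.pi_pi, Finset.prod_const, Finset.card_univ, Fintype.card_fin,
      ENNReal.ofReal_pow measureReal_nonneg, ofReal_measureReal]
  rw [prob_compl_eq_one_sub (MeasurableSet.univ_pi fun _ => hO), h1, ← ENNReal.ofReal_one,
    ← ENNReal.ofReal_sub _ (by positivity)]

/-- For R < 1/2, solve `splitProb (T - 1) l = R`. If all roots are far from a, every member of the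
ball labels the pair as a does. -/
theorem planLaw_disRegion_le {T : ℕ} (hT : 2 ≤ T) {a R : ℝ} (ha : a ∈ Set.Ioo (0 : ℝ) 1)
    (hR : 0 < R) :
    planLaw T (disRegion (prefBall (planLaw T) (edModel T) (edPref T a) R)) ≤
      ENNReal.ofReal (2 * R) := by
  rcases le_or_gt (1 / 2) R with h | h
  · refine prob_le_one.trans ?_
    rw [← ENNReal.ofReal_one]
    exact ENNReal.ofReal_le_ofReal (by linarith)
  have hN : T - 1 ≠ 0 := by omega
  obtain ⟨l, hl0, hl1, hl⟩ : ∃ l : ℝ, 0 ≤ l ∧ l ≤ 1 / 2 ∧ splitProb (T - 1) l = R := by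
    have h0 : 0 ≤ 1 - 2 * R := by linarith
    refine ⟨(1 - (1 - 2 * R) ^ (((T - 1 : ℕ) : ℝ)⁻¹)) / 2, ?_, ?_, ?_⟩
    · have := Real.rpow_le_one h0 (by linarith) (by positivity : 0 ≤ ((T - 1 : ℕ) : ℝ)⁻¹)
      linarith
    · have := Real.rpow_nonneg h0 (((T - 1 : ℕ) : ℝ)⁻¹)
      linarith
    · rw [splitProb, mul_div_cancel₀ _ two_ne_zero, sub_sub_cancel, Real.rpow_inv_natCast_pow h0 hN]
      ring
  rw [planLaw_apply]
  calc _ ≤ rootLaw (T - 1) (Set.univ.pi fun _ => farSet a l)ᶜ := by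
        refine measure_mono ?_
        rintro r ⟨h, hh, h', hh', hr⟩ hfar
        rw [mem_prefBall_iff hT ha hR.le] at hh hh'
        obtain ⟨b, hb, rfl, hab⟩ := hh
        obtain ⟨b', hb', rfl, hab'⟩ := hh'
        rw [mem_symmDiff_iff_not_iff, planPair_mem_edPref_iff hT r hb.1,
          planPair_mem_edPref_iff hT r hb'.1] at hr
        have hfar' : ∀ i, r i ∈ farSet a l := fun i => hfar i (Set.mem_univ i)
        rw [← hl] at hab hab'
        exact hr ((rootProd_nonneg_iff_of_pos (rootProd_mul_pos_of_farSet hb hl0 hl1 hfar' hab)).symm.trans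
          (rootProd_nonneg_iff_of_pos (rootProd_mul_pos_of_farSet hb' hl0 hl1 hfar' hab')))
    _ = _ := rootLaw_compl_pi _ (measurableSet_farSet a l)
    _ ≤ _ := by
      refine ENNReal.ofReal_le_ofReal ?_
      have := pow_le_pow_left₀ (by linarith)
        (le_unitLaw_farSet (Set.Ioo_subset_Icc_self ha) hl0 hl1) (T - 1)
      rw [← hl, splitProb]
      linarith

/-- A simple root inside an interval makes the polynomial change its sign there. -/
theorem exists_rootProd_neg {N : ℕ} {r : Fin N → ℝ} (hr : Function.Injective r) {i : Fin N}
    {U : Set ℝ} (hU : IsOpen U) (hi : r i ∈ U) : ∃ b ∈ U, rootProd r b < 0 := by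
  classical
  let q : ℝ → ℝ := fun x => ∏ j ∈ Finset.univ.erase i, (x - r j)
  have hq : Continuous q := by fun_prop
  have hfac : ∀ x, rootProd r x = (x - r i) * q x := fun x =>
    (Finset.mul_prod_erase Finset.univ (fun j => x - r j) (Finset.mem_univ i)).symm
  have hqi : q (r i) ≠ 0 := Finset.prod_ne_zero_iff.2 fun j hj =>
    sub_ne_zero.2 fun h => (Finset.ne_of_mem_erase hj) (hr h).symm
  rcases lt_or_gt_of_ne hqi with h | h
  · have hev : ∀ᶠ x in nhds (r i), q x < 0 ∧ x ∈ U :=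
      (hq.continuousAt.eventually_lt continuousAt_const h).and (hU.mem_nhds hi)
    obtain ⟨x, ⟨hx, hxU⟩, hlt⟩ :=
      ((hev.filter_mono nhdsWithin_le_nhds).and (self_mem_nhdsWithin (s := Set.Ioi (r i)))).exists
    exact ⟨x, hxU, by rw [hfac]; exact mul_neg_of_pos_of_neg (sub_pos.2 hlt) hx⟩
  · have hev : ∀ᶠ x in nhds (r i), 0 < q x ∧ x ∈ U :=
      (continuousAt_const.eventually_lt hq.continuousAt h).and (hU.mem_nhds hi)
    obtain ⟨x, ⟨hx, hxU⟩, hlt⟩ :=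
      ((hev.filter_mono nhdsWithin_le_nhds).and (self_mem_nhdsWithin (s := Set.Iio (r i)))).exists
    exact ⟨x, hxU, by rw [hfac]; exact mul_neg_of_neg_of_pos (sub_neg.2 hlt) hx⟩

/-- Take l so small that (a - l, a + l) stays inside (0, 1). A root in this interval has probability
exactly 2R and, being almost surely simple, splits the ball. -/
theorem exists_le_planLaw_disRegion {T : ℕ} (hT : 2 ≤ T) {a : ℝ} (ha : a ∈ Set.Ioo (0 : ℝ) 1) :
    ∃ R : ℝ, 0 < R ∧ ENNReal.ofReal (2 * R) ≤
      planLaw T (disRegion (prefBall (planLaw T) (edModel T) (edPref T a) R)) := by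
  obtain ⟨ha0, ha1⟩ := ha
  obtain ⟨l, hl0, hla, hl1⟩ : ∃ l : ℝ, 0 < l ∧ l ≤ a ∧ l ≤ 1 - a :=
    ⟨min a (1 - a), lt_min ha0 (sub_pos.2 ha1), min_le_left _ _, min_le_right _ _⟩
  have hN : T - 1 ≠ 0 := by omega
  have hR : 0 < splitProb (T - 1) l :=
    (lt_min hl0 (by linarith)).trans_le (min_le_splitProb hN hl0.le (by linarith))
  refine ⟨splitProb (T - 1) l, hR, ?_⟩
  have hmeas : unitLaw.real (Set.Ioo (a - l) (a + l))ᶜ = 1 - 2 * l := by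
    rw [probReal_compl_eq_one_sub measurableSet_Ioo,
      unitLaw_real_of_subset (by linarith) (by linarith) (by linarith)]
    ring
  have hlaw := rootLaw_compl_pi (T - 1) (measurableSet_Ioo (a := a - l) (b := a + l)).compl
  rw [hmeas] at hlaw
  have h2R : 2 * splitProb (T - 1) l = 1 - (1 - 2 * l) ^ (T - 1) := by
    rw [splitProb]; ring
  rw [h2R, ← hlaw, planLaw_apply]
  refine measure_mono_ae ?_
  filter_upwards [ae_injective (T - 1)] with r hinj hr
  obtain ⟨i, hi⟩ : ∃ i, r i ∈ Set.Ioo (a - l) (a + l) := by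
    by_contra hne
    push Not at hne
    exact hr fun i _ => hne i
  obtain ⟨b, hb, hneg⟩ := exists_rootProd_neg hinj isOpen_Ioo hi
  have hball : ∀ c ∈ Set.Ioo (a - l) (a + l), edPref T c ∈
      prefBall (planLaw T) (edModel T) (edPref T a) (splitProb (T - 1) l) := by
    intro c hc
    rw [mem_prefBall_iff hT ⟨ha0, ha1⟩ hR.le]
    refine ⟨c, ⟨by linarith [hc.1], by linarith [hc.2]⟩, rfl, splitProb_le_of_abs ?_⟩
    have : |a - c| ≤ l := abs_le.2 ⟨by linarith [hc.2], by linarith [hc.1]⟩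
    rw [abs_of_nonneg (by linarith)]
    linarith
  -- At the root itself there is a tie, which counts as preference; at b the polynomial is negative.
  refine ⟨_, hball b hb, _, hball (r i) hi, ?_⟩
  rw [mem_symmDiff_iff_not_iff, planPair_mem_edPref_iff hT r (by linarith [hb.1]),
    planPair_mem_edPref_iff hT r (by linarith [hi.1])]
  have h0 : rootProd r (r i) = 0 := Finset.prod_eq_zero (Finset.mem_univ i) (sub_self _)
  exact fun h => hneg.not_ge (h.2 h0.ge)

theorem disagreementCoeff_planLaw {T : ℕ} (hT : 2 ≤ T) {a : ℝ} (ha : a ∈ Set.Ioo (0 : ℝ) 1) :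
    disagreementCoeff (planLaw T) (edModel T) (edPref T a) = 2 := by
  have hmul : ∀ R : ℝ, ENNReal.ofReal (2 * R) = 2 * ENNReal.ofReal R := fun R => by
    rw [ENNReal.ofReal_mul zero_le_two, ENNReal.ofReal_ofNat]
  refine le_antisymm (iSup₂_le fun R hR => ?_) ?_
  · refine ENNReal.div_le_of_le_mul ?_
    rw [← hmul]
    exact planLaw_disRegion_le hT ha hR
  · obtain ⟨R, hR, hle⟩ := exists_le_planLaw_disRegion hT ha
    refine le_iSup₂_of_le R hR ?_
    rw [ENNReal.le_div_iff_mul_le (Or.inl (ENNReal.ofReal_pos.2 hR).ne')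
      (Or.inl ENNReal.ofReal_ne_top), ← hmul]
    exact hle

/-! ### The CAL algorithm -/

section CAL

variable {α : Type*} {P : Set (Set α)} {target : Set α}

/-- A label that is not requested is unanimous in the version space. As the target belongs to it,
skipping the label loses no information. -/
theorem calVersion_eq (htarget : target ∈ P) (z : ℕ → α) (m : ℕ) :
    calVersion P target z m = {h | h ∈ P ∧ ∀ k < m, (z k ∈ h ↔ z k ∈ target)} := by
  induction m with
  | zero => simp [calVersion]
  | succ m ih =>
    have hsucc : ∀ h : Set α, (∀ k < m + 1, (z k ∈ h ↔ z k ∈ target)) ↔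
        (∀ k < m, (z k ∈ h ↔ z k ∈ target)) ∧ (z m ∈ h ↔ z m ∈ target) := fun h =>
      Nat.forall_lt_succ_right
    simp only [calVersion, ih]
    split_ifs with hz
    · ext h
      simp only [Set.mem_ofPred_eq, hsucc, and_assoc]
    · ext h
      simp only [Set.mem_ofPred_eq, hsucc]
      refine ⟨fun ⟨h1, h2⟩ => ⟨h1, h2, ?_⟩, fun ⟨h1, h2, _⟩ => ⟨h1, h2⟩⟩
      by_contra hne
      exact hz ⟨h, ih ▸ ⟨h1, h2⟩, target, ih ▸ ⟨htarget, fun _ _ => Iff.rfl⟩,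
        mem_symmDiff_iff_not_iff.2 hne⟩

theorem calVersion_antitone (htarget : target ∈ P) (z : ℕ → α) :
    Antitone (calVersion P target z) := by
  intro m n hmn h hh
  rw [calVersion_eq htarget] at hh ⊢
  exact ⟨hh.1, fun k hk => hh.2 k (hk.trans_le hmn)⟩

theorem disRegion_mono {V W : Set (Set α)} (h : V ⊆ W) : disRegion V ⊆ disRegion W :=
  fun _ ⟨h1, hh1, h2, hh2, hz⟩ => ⟨h1, h hh1, h2, h hh2, hz⟩

end CAL

theorem infinitePi_not_calVersion_subset_le {T : ℕ} (hT : 2 ≤ T) {a r : ℝ}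
    (ha : a ∈ Set.Ioo (0 : ℝ) 1) (hr : 0 ≤ r) {n : ℕ} (hn : n ≠ 0) :
    Measure.infinitePi (fun _ : ℕ => planLaw T)
      {z | ¬ calVersion (edModel T) (edPref T a) z (n + 1) ⊆
        prefBall (planLaw T) (edModel T) (edPref T a) r} ≤
      ENNReal.ofReal (24 * T * Real.exp (-(n * r / 2))) := by
  have hmem : edPref T a ∈ edModel T := ⟨a, ha.1, ha.2, rfl⟩
  rw [infinitePi_planLaw_apply]
  refine le_trans (measure_mono ?_) ((infinitePi_initial_le (rootLaw (T - 1)) (n + 1) _).trans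
    ((pi_exists_consistent_le hn (Set.Ioo_subset_Icc_self ha) hr).trans
      (ENNReal.ofReal_le_ofReal ?_)))
  · intro w hw
    have hw' : ¬ calVersion (edModel T) (edPref T a) (fun k => planPair T (w k)) (n + 1) ⊆
        prefBall (planLaw T) (edModel T) (edPref T a) r := hw
    obtain ⟨h, hV, hB⟩ := Set.not_subset.1 hw'
    rw [calVersion_eq hmem] at hV
    obtain ⟨⟨b, hb0, hb1, rfl⟩, hagree⟩ := hV
    refine ⟨b, ⟨hb0.le, hb1.le⟩, ?_, fun j => not_mem_oddSplit_of_iff ?_⟩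
    · by_contra hle
      exact hB ((mem_prefBall_iff hT ha hr _).2 ⟨b, ⟨hb0, hb1⟩, rfl, not_lt.1 hle⟩)
    · rw [← planPair_mem_edPref_iff hT _ ha.1, ← planPair_mem_edPref_iff hT _ hb0]
      exact (hagree j j.2).symm
  · refine mul_le_mul_of_nonneg_right ?_ (Real.exp_nonneg _)
    rw [Nat.cast_sub (by omega)]
    push_cast
    linarith

/-! ### Counting label requests over dyadic phases -/

theorem le_log_div {A J k : ℕ} (hA : A ≠ 0) (h : A * 2 ^ J ≤ k) : J ≤ Nat.log 2 (k / A) := by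
  have h1 : 2 ^ J ≤ k / A := (Nat.le_div_iff_mul_le (Nat.pos_of_ne_zero hA)).2 (by rwa [mul_comm])
  have h2 : k / A ≠ 0 := (lt_of_lt_of_le (by positivity) h1).ne'
  exact (Nat.le_log_iff_pow_le (by norm_num) h2).2 h1

/-- The block from A·2^j to A·2^(j+1) has A·2^j terms of size at most 2·2^(-j), so it adds at most
2A; the first A terms add at most A. -/
theorem sum_dyadic_le {A : ℕ} (hA : A ≠ 0) {p : ℕ → ℝ} (h1 : ∀ k, p k ≤ 1)
    (h2 : ∀ k, p k ≤ 2 * (1 / 2) ^ Nat.log 2 (k / A)) (J : ℕ) :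
    ∑ k ∈ Finset.range (A * 2 ^ J), p k ≤ 2 * A * (J + 1) := by
  induction J with
  | zero =>
    refine (Finset.sum_le_sum fun k _ => h1 k).trans ?_
    simp
    have : (0 : ℝ) ≤ A := by positivity
    linarith
  | succ J ih =>
    have hle : A * 2 ^ J ≤ A * 2 ^ (J + 1) := by gcongr <;> simp
    rw [← Finset.sum_range_add_sum_Ico p hle]
    have hI : ∑ k ∈ Finset.Ico (A * 2 ^ J) (A * 2 ^ (J + 1)), p k ≤ 2 * A := by
      have hk : ∀ k ∈ Finset.Ico (A * 2 ^ J) (A * 2 ^ (J + 1)), p k ≤ 2 * (1 / 2) ^ J := by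
        intro k hk
        refine (h2 k).trans ?_
        have := pow_le_pow_of_le_one (by norm_num : (0 : ℝ) ≤ 1 / 2) (by norm_num)
          (le_log_div hA (Finset.mem_Ico.1 hk).1)
        linarith
      refine (Finset.sum_le_card_nsmul _ _ _ hk).trans (le_of_eq ?_)
      rw [Nat.card_Ico, pow_succ, ← mul_assoc, mul_two, Nat.add_sub_cancel, nsmul_eq_mul]
      push_cast
      have : (2 : ℝ) ^ J * (1 / 2) ^ J = 1 := by rw [← mul_pow]; norm_num
      linear_combination 2 * (A : ℝ) * this
    push_cast
    linarith

theorem calSuffices_planLaw {T : ℕ} (hT : 2 ≤ T) {A J M : ℕ} (hA : 2 ≤ A) {ε δ : ℝ}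
    (hε : (1 / 2) ^ J ≤ ε)
    (hδ : J * (24 * T * Real.exp (-((A - 1) / 2))) +
      Real.exp (2 * A * (J + 1)) / 2 ^ (M + 1) < δ) (hJ : J ≠ 0) :
    CALSuffices (planLaw T) (edModel T) ε δ M := by
  classical
  refine ⟨A * 2 ^ J, ?_⟩
  rintro _ ⟨a, ha0, ha1, rfl⟩
  have ha : a ∈ Set.Ioo (0 : ℝ) 1 := ⟨ha0, ha1⟩
  have hmem : edPref T a ∈ edModel T := ⟨a, ha0, ha1, rfl⟩
  set μ := planLaw T
  let ball : ℕ → Set (Set (Plan T × Plan T)) := fun j =>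
    prefBall μ (edModel T) (edPref T a) ((1 / 2) ^ j)
  let V := calVersion (edModel T) (edPref T a)
  -- These regions do not depend on the stream, so hits are independent and Chernoff applies, unlike
  -- for the random regions of CAL. The measurable hull keeps the measure.
  let W : ℕ → Set (Plan T × Plan T) := fun k =>
    toMeasurable μ (disRegion (ball (Nat.log 2 (k / A))))
  have hW : ∀ k, μ.real (W k) ≤ 2 * (1 / 2) ^ Nat.log 2 (k / A) := fun k => by
    refine ENNReal.toReal_le_of_le_ofReal (by positivity) ?_
    rw [measure_toMeasurable]
    exact planLaw_disRegion_le hT ha (by positivity)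
  let G : ℕ → Set (ℕ → Plan T × Plan T) := fun j => {z | ¬ V z (A * 2 ^ j) ⊆ ball j}
  let H : Set (ℕ → Plan T × Plan T) :=
    {z | (fun j : Fin (A * 2 ^ J) => z j) ∈ {w : Fin (A * 2 ^ J) → Plan T × Plan T |
      M + 1 ≤ (Finset.univ.filter fun j : Fin (A * 2 ^ J) => w j ∈ W j).card}}
  have hV0 : ∀ z k, V z k ⊆ ball 0 := fun z k h hh => by
    rw [show V = calVersion (edModel T) (edPref T a) from rfl, calVersion_eq hmem] at hh
    exact ⟨hh.1, prob_le_one.trans (by simp)⟩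
  have hsub : {z | ¬ (calRequests (edModel T) (edPref T a) z (A * 2 ^ J) ≤ M ∧
      V z (A * 2 ^ J) ⊆ prefBall μ (edModel T) (edPref T a) ε)} ⊆
      (⋃ j ∈ Finset.Icc 1 J, G j) ∪ H := by
    intro z hz
    by_contra hgood
    obtain ⟨hG, hH⟩ := not_or.1 hgood
    have hG' : ∀ j ≤ J, V z (A * 2 ^ j) ⊆ ball j := by
      intro j hj
      rcases Nat.eq_zero_or_pos j with rfl | hj0
      · exact hV0 z _
      · by_contra hne
        exact hG (Set.mem_biUnion (x := j)
          (Finset.mem_coe.2 (Finset.mem_Icc.2 ⟨hj0, hj⟩)) hne)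
    have hreq : calRequests (edModel T) (edPref T a) z (A * 2 ^ J) ≤ M := by
      have hcard : (Finset.univ.filter fun j : Fin (A * 2 ^ J) => z j ∈ W j).card ≤ M :=
        Nat.lt_succ_iff.1 (not_le.1 hH)
      refine le_trans ?_ hcard
      rw [Finset.card_filter, Fin.sum_univ_eq_sum_range (fun k => if z k ∈ W k then 1 else 0),
        ← Finset.card_filter, calRequests]
      refine Finset.card_le_card fun k hk => ?_
      rw [Finset.mem_filter] at hk ⊢
      refine ⟨hk.1, subset_toMeasurable _ _ (disRegion_mono ?_ hk.2)⟩
      have hkJ : k < A * 2 ^ J := Finset.mem_range.1 hk.1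
      -- Before time A the quotient is 0 and its logarithm is 0 by convention, which selects the
      -- ball of radius 1, the whole model.
      rcases lt_or_ge k A with hkA | hkA
      · rw [Nat.div_eq_of_lt hkA, Nat.log_zero_right]
        exact hV0 z k
      · have h0 : k / A ≠ 0 := (Nat.div_pos hkA (by omega)).ne'
        have hlog : A * 2 ^ Nat.log 2 (k / A) ≤ k :=
          (Nat.mul_le_mul_left A (Nat.pow_log_le_self 2 h0)).trans (Nat.mul_div_le k A)
        have hlogJ : Nat.log 2 (k / A) ≤ J :=
          (Nat.log_lt_of_lt_pow h0 ((Nat.div_lt_iff_lt_mul (by omega)).2 (by rwa [mul_comm]))).le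
        exact (calVersion_antitone hmem z hlog).trans (hG' _ hlogJ)
    refine hz ⟨hreq, (hG' J le_rfl).trans fun h hh => ⟨hh.1, hh.2.trans ?_⟩⟩
    exact ENNReal.ofReal_le_ofReal hε
  have hGle : ∀ j, Measure.infinitePi (fun _ : ℕ => μ) (G j) ≤
      ENNReal.ofReal (24 * T * Real.exp (-((A - 1) / 2))) := by
    intro j
    have h2j : 1 ≤ 2 ^ j := Nat.one_le_two_pow
    obtain ⟨n, hn⟩ : ∃ n, A * 2 ^ j = n + 1 := ⟨A * 2 ^ j - 1, by
      have : 0 < A * 2 ^ j := by positivity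
      omega⟩
    have hn0 : n ≠ 0 := by nlinarith
    simp only [G, hn, ball, V]
    refine (infinitePi_not_calVersion_subset_le hT ha (by positivity) hn0).trans
      (ENNReal.ofReal_le_ofReal ?_)
    gcongr
    have hn' : (A : ℝ) * 2 ^ j = n + 1 := by exact_mod_cast hn
    have h3 : (2 : ℝ) ^ j * (1 / 2) ^ j = 1 := by rw [← mul_pow]; norm_num
    have h4 : ((1 : ℝ) / 2) ^ j ≤ 1 := pow_le_one₀ (by norm_num) (by norm_num)
    -- One sample is lost to n + 1 = A·2^j, hence A - 1 rather than A in the exponent.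
    have h5 : (n : ℝ) * (1 / 2) ^ j = A - (1 / 2) ^ j := by
      linear_combination (A : ℝ) * h3 - (1 / 2) ^ j * hn'
    linarith
  have hHle : Measure.infinitePi (fun _ : ℕ => μ) H ≤
      ENNReal.ofReal (Real.exp (2 * A * (J + 1)) / 2 ^ (M + 1)) := by
    refine (infinitePi_initial_le μ _ _).trans ?_
    rw [← ofReal_measureReal]
    refine ENNReal.ofReal_le_ofReal ((pi_count_ge_le μ (W := fun j : Fin (A * 2 ^ J) => W j)
      (fun j => measurableSet_toMeasurable _ _) (M + 1)).trans ?_)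
    gcongr
    rw [Fin.prod_univ_eq_prod_range (fun k => 1 + μ.real (W k))]
    calc _ ≤ ∏ k ∈ Finset.range (A * 2 ^ J), Real.exp (μ.real (W k)) :=
          Finset.prod_le_prod (fun k _ => add_nonneg zero_le_one measureReal_nonneg)
            fun k _ => by rw [add_comm]; exact Real.add_one_le_exp _
      _ = Real.exp (∑ k ∈ Finset.range (A * 2 ^ J), μ.real (W k)) := (Real.exp_sum _ _).symm
      _ ≤ _ := Real.exp_le_exp.2
          (sum_dyadic_le (by omega) (fun k => measureReal_le_one) hW J)
  calc _ ≤ _ := measure_mono hsub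
    _ ≤ _ := measure_union_le _ _
    _ ≤ (∑ j ∈ Finset.Icc 1 J, ENNReal.ofReal (24 * T * Real.exp (-((A - 1) / 2)))) +
        ENNReal.ofReal (Real.exp (2 * A * (J + 1)) / 2 ^ (M + 1)) :=
      add_le_add ((measure_biUnion_finset_le _ _).trans
        (Finset.sum_le_sum fun j _ => hGle j)) hHle
    _ = ENNReal.ofReal (J * (24 * T * Real.exp (-((A - 1) / 2))) +
        Real.exp (2 * A * (J + 1)) / 2 ^ (M + 1)) := by
      rw [Finset.sum_const, Nat.card_Icc, Nat.add_sub_cancel, nsmul_eq_mul,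
        ENNReal.ofReal_add (by positivity) (by positivity),
        ENNReal.ofReal_mul (p := (J : ℝ)) (by positivity), ENNReal.ofReal_natCast]
    _ < _ := by
      rw [ENNReal.ofReal_lt_ofReal_iff_of_nonneg (by positivity)]
      exact hδ

theorem calLabelComplexity_le_of_calSuffices {α : Type*} [MeasurableSpace α] {μ : Measure α}
    [IsProbabilityMeasure μ] {P : Set (Set α)} {ε δ : ℝ} {M : ℕ} (h : CALSuffices μ P ε δ M) :
    (calLabelComplexity μ P ε δ : ℝ≥0∞) ≤ ENNReal.ofReal M := by
  have h1 : calLabelComplexity μ P ε δ ≤ (M : ℕ∞) := iInf₂_le M h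
  rw [ENNReal.ofReal_natCast]
  exact_mod_cast ENat.toENNReal_le.2 h1

theorem calLabelComplexity_planLaw_le {T : ℕ} (hT : 2 ≤ T) {ε δ : ℝ} (hε0 : 0 < ε)
    (hε : ε ≤ 1 / 2) (hδ0 : 0 < δ) (hδ : δ < 1) :
    (calLabelComplexity (planLaw T) (edModel T) ε δ : ℝ≥0∞) ≤
      ENNReal.ofReal (1740 * (Real.log (1 / ε) *
        (Real.log T + Real.log (Real.log (1 / ε) / δ)))) := by
  set lam := Real.log (1 / ε) with hlam
  set L := Real.log T + Real.log (lam / δ) with hL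
  have hlog2 := Real.log_two_gt_d9
  have hTr : (2 : ℝ) ≤ T := by exact_mod_cast hT
  have hlam2 : Real.log 2 ≤ lam := by
    refine Real.log_le_log two_pos ?_
    rw [le_div_iff₀ hε0]
    linarith
  have hlam0 : 0 < lam := by linarith
  have hexpL : Real.exp L = T * lam / δ := by
    rw [hL, Real.exp_add, Real.exp_log (by linarith), Real.exp_log (by positivity), mul_div_assoc]
  have hLδ : 1 / 4 - Real.log δ ≤ L := by
    have h1 : L = Real.log (T * lam) - Real.log δ := by
      rw [hL, Real.log_mul (by positivity) (by positivity),
        Real.log_div (by positivity) (by positivity)]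
      ring
    have h2 : 1.38 ≤ T * lam := by nlinarith
    have h3 := Real.one_sub_inv_le_log_of_pos (by linarith : (0 : ℝ) < T * lam)
    have h4 : (T * lam)⁻¹ ≤ (1.38)⁻¹ := inv_anti₀ (by norm_num) h2
    have h5 : (1.38 : ℝ)⁻¹ ≤ 3 / 4 := by norm_num
    linarith
  have hlogδ : Real.log δ ≤ 0 := Real.log_nonpos hδ0.le hδ.le
  have hL4 : 1 / 4 ≤ L := by linarith
  obtain ⟨J, hJ0, hJlow, hJup⟩ : ∃ J : ℕ, J ≠ 0 ∧ (1 / 2 : ℝ) ^ J ≤ ε ∧ (J : ℝ) ≤ 3 * lam := by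
    have h0 : 0 < lam / Real.log 2 := by positivity
    refine ⟨⌈lam / Real.log 2⌉₊, (Nat.ceil_pos.2 h0).ne', ?_, ?_⟩
    · have h1 : lam ≤ ⌈lam / Real.log 2⌉₊ * Real.log 2 :=
        (div_le_iff₀ (by positivity)).1 (Nat.le_ceil _)
      rw [← Real.log_le_log_iff (by positivity) hε0, Real.log_pow, one_div, Real.log_inv]
      have h2 : lam = -Real.log ε := by rw [hlam, one_div, Real.log_inv]
      linarith
    · refine (Nat.ceil_lt_add_one h0.le).le.trans ?_
      have h1 : 1 ≤ lam / Real.log 2 := (one_le_div (by positivity)).2 hlam2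
      have h2 : lam / Real.log 2 ≤ 3 / 2 * lam := by
        rw [div_le_iff₀ (by positivity)]
        nlinarith
      linarith
  -- The 13 gives (A - 1)/2 ≥ L + 6, where exp(-L) = δ/(Tλ), λ = log(1/ε), pays for the union bound
  -- and exp(-6) for constants. The 58 uses L ≥ 1/4. Together 10·58·3 = 1740.
  obtain ⟨A, hAlow, hAup⟩ : ∃ A : ℕ, 2 * L + 13 ≤ A ∧ (A : ℝ) ≤ 58 * L :=
    ⟨⌈2 * L + 13⌉₊, Nat.le_ceil _,
      (Nat.ceil_lt_add_one (by linarith)).le.trans (by linarith)⟩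
  have hA2 : 2 ≤ A := by
    have : (2 : ℝ) ≤ A := by linarith
    exact_mod_cast this
  have hJ1 : (1 : ℝ) ≤ J := by exact_mod_cast Nat.one_le_iff_ne_zero.2 hJ0
  refine (calLabelComplexity_le_of_calSuffices (calSuffices_planLaw hT (M := 10 * A * J) hA2 hJlow
    ?_ hJ0)).trans (ENNReal.ofReal_le_ofReal ?_)
  · have hb1 : J * (24 * T * Real.exp (-((A - 1) / 2))) ≤ δ / 4 := by
      have h6 : (300 : ℝ) ≤ Real.exp 6 := by
        have h1 := Real.exp_one_gt_d9
        have h2 : Real.exp 6 = Real.exp 1 ^ 6 := by rw [← Real.exp_nat_mul]; norm_num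
        have h3 : (2.7 : ℝ) ^ 6 ≤ Real.exp 1 ^ 6 := by gcongr; linarith
        rw [h2]
        norm_num at h3 ⊢
        linarith
      have h1 : Real.exp (-((A - 1) / 2)) ≤ Real.exp (-(L + 6)) :=
        Real.exp_le_exp.2 (by linarith)
      have h2 : Real.exp (-(L + 6)) = δ / (T * lam) * (Real.exp 6)⁻¹ := by
        rw [Real.exp_neg, Real.exp_add, hexpL, mul_inv, inv_div]
      have h3 : (Real.exp 6)⁻¹ ≤ (300 : ℝ)⁻¹ := inv_anti₀ (by norm_num) h6
      calc J * (24 * T * Real.exp (-((A - 1) / 2)))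
          ≤ 3 * lam * (24 * T * (δ / (T * lam) * (300 : ℝ)⁻¹)) := by
            gcongr
            exact h1.trans (h2.le.trans (by gcongr))
        _ = 72 / 300 * δ := by field_simp; norm_num
        _ ≤ δ / 4 := by linarith
    -- Since J ≥ 1, 2A(J + 1) ≤ 4AJ, while 10AJ·log 2 ≥ 5AJ. The spare AJ absorbs log(4/δ) because A
    -- ≥ 2L + 13 and L ≥ 1/4 - log δ.
    have hb2 : Real.exp (2 * A * (J + 1)) / 2 ^ (10 * A * J + 1) ≤ δ / 4 := by
      rw [div_le_iff₀ (by positivity), ← Real.log_le_log_iff (by positivity) (by positivity),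
        Real.log_exp, Real.log_mul (by positivity) (by positivity),
        Real.log_div (by positivity) (by norm_num), Real.log_pow]
      have h4 : Real.log 4 ≤ 3 := (Real.log_le_sub_one_of_pos (by norm_num)).trans (by norm_num)
      have hAJ : (A : ℝ) ≤ A * J := le_mul_of_one_le_right (by positivity) hJ1
      push_cast
      have h5 : (10 * A * J + 1) * (1 / 2 : ℝ) ≤ (10 * A * J + 1) * Real.log 2 := by
        gcongr
        linarith
      linarith
    linarith
  · push_cast
    have h1 : (A : ℝ) * J ≤ 58 * L * (3 * lam) := by gcongr
    linarith

theorem theorem3p5 :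
    ∃ C : ℝ, 0 < C ∧ ∀ T : ℕ, 2 ≤ T →
      ∃ (μ : Measure (Plan T × Plan T)) (_ : IsProbabilityMeasure μ),
        μ.map (diffClass T) = rootClassLaw T ∧
        (∀ h ∈ edModel T, disagreementCoeff μ (edModel T) h = 2) ∧
        ∀ ε δ : ℝ, 0 < ε → ε ≤ 1 / 2 → 0 < δ → δ < 1 →
          (calLabelComplexity μ (edModel T) ε δ : ℝ≥0∞) ≤
            ENNReal.ofReal (C * (Real.log (1 / ε) *
              (Real.log T + Real.log (Real.log (1 / ε) / δ)))) := by
  refine ⟨1740, by norm_num, fun T hT => ⟨planLaw T, isProbabilityMeasure_planLaw T,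
    map_diffClass_planLaw T, ?_, fun ε δ h1 h2 h3 h4 =>
      calLabelComplexity_planLaw_le hT h1 h2 h3 h4⟩⟩
  rintro _ ⟨a, ha0, ha1, rfl⟩
  exact disagreementCoeff_planLaw hT ⟨ha0, ha1⟩
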